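/- A tiling system $S=(T,H,V,t_1)$ consists of a finite set $T$ of tiles, horizontal constraints $H\subseteq T\times T$, vertical constraints $V\subseteq T\times T$, and a designated tile $t_1\in T$. A valid tiling of the $N\times N$ grid is a placement of one tile of $T$ in each cell such that $(s,t)\in H$ whenever $s$ is immediately to the left of $t$, $(s,t)\in V$ whenever $s$ is immediately below $t$, and $t_1$ is in each of the four corners. For a fixed $S$, the problem $\mathrm{TILING}_S$ has as its only input an integer $N\ge 1$, written in binary, and asks whether the $N\times N$ grid has a valid tiling. Let $\mathrm{NEXP}=\bigcup_p \mathrm{NTIME}\bigl(2^{p(n)}\bigr)$, the union being over all polynomials $p$ with coefficients in $\mathbb{N}$. Theorem. TILING is $\mathrm{NEXP}$-complete. That is, for every tiling system $S$ the problem $\mathrm{TILING}_S$ is in $\mathrm{NEXP}$, and there is a fixed tiling system $S$ such that $\mathrm{TILING}_S$ is $\mathrm{NEXP}$-complete: every language in $\mathrm{NEXP}$ is reducible to $\mathrm{TILING}_S$ by a polynomial-time many-one reduction. -/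

import Mathlib

/-! ### Nondeterministic Turing machines -/

/-- A nondeterministic Turing machine with one semi-infinite tape, reading binary inputs.
In state `q` with the head on symbol `a`, the triple `(q', b, d) ∈ δ q a` is an allowed move:
write `b`, go to state `q'` and move the head one cell in direction `d`. -/
structure NTM where
  /-- the states -/
  Q : Type
  /-- the tape alphabet -/
  Γ : Type
  [finQ : Finite Q]
  [finΓ : Finite Γ]
  /-- the blank symbol -/
  blank : Γ
  /-- the tape symbol representing an input bit -/
  bit : Bool → Γ
  bit_injective : Function.Injective bit
  bit_ne_blank : ∀ b, bit b ≠ blank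
  /-- the start state -/
  start : Q
  /-- the accepting state -/
  accept : Q
  /-- the transition relation -/
  δ : Q → Γ → Set (Q × Γ × Turing.Dir)

namespace NTM

/-- A configuration: state, head position and tape contents (cell `0` is the leftmost cell). -/
structure Cfg (M : NTM) where
  state : M.Q
  head : ℕ
  tape : ℕ → M.Γ

/-- The head position after a move; a head on the leftmost cell that is sent to the left
stays where it is. -/
def moveHead : Turing.Dir → ℕ → ℕ
  | .left, i => i - 1
  | .right, i => i + 1

variable (M : NTM)

/-- The initial configuration on input `x`: the input is written from the leftmost cell on,
all other cells are blank, and the head is on the leftmost cell. -/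
def init (x : List Bool) : M.Cfg where
  state := M.start
  head := 0
  tape i := (x[i]?).elim M.blank M.bit

/-- `c'` is a possible successor of `c`. -/
def Step (c c' : M.Cfg) : Prop :=
  ∃ (q : M.Q) (b : M.Γ) (d : Turing.Dir), (q, b, d) ∈ M.δ c.state (c.tape c.head) ∧
    c' = ⟨q, moveHead d c.head, Function.update c.tape c.head b⟩

/-- Some computation path of exactly `t` steps leads from `c` to `c'`. -/
def ReachesIn : ℕ → M.Cfg → M.Cfg → Prop
  | 0, c, c' => c = c'
  | t + 1, c, c' => ∃ c₁, ReachesIn t c c₁ ∧ M.Step c₁ c'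

/-- Some computation path on input `x` reaches the accepting state within `t` steps. -/
def AcceptsWithin (x : List Bool) (t : ℕ) : Prop :=
  ∃ s ≤ t, ∃ c : M.Cfg, M.ReachesIn s (M.init x) c ∧ c.state = M.accept

/-- `M` accepts the language `L` in time `T`: it accepts exactly the words of `L`, and every word
of `L` of length `n` has an accepting computation of at most `T n` steps. -/
def AcceptsInTime (L : Language Bool) (T : ℕ → ℕ) : Prop :=
  (∀ x, x ∈ L ↔ ∃ t, M.AcceptsWithin x t) ∧ ∀ x ∈ L, M.AcceptsWithin x (T x.length)

end NTM

/-! ### The class NEXP and completeness for it -/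

/-- `NTIME T`: the languages accepted by a nondeterministic Turing machine in time `T`. -/
def NTIME (T : ℕ → ℕ) : Set (Language Bool) :=
  {L | ∃ M : NTM, M.AcceptsInTime L T}

/-- Nondeterministic exponential time, the union of `NTIME (2 ^ p(n))` over all polynomials `p`. -/
def NEXP : Set (Language Bool) :=
  ⋃ p : Polynomial ℕ, NTIME fun n => 2 ^ p.eval n

/-- Polynomial-time many-one reducibility. -/
def PolyTimeReducible (L L' : Language Bool) : Prop :=
  ∃ f : List Bool → List Bool,
    Nonempty (Turing.TM2ComputableInPolyTime (id : List Bool → List Bool) id f) ∧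
      ∀ x, x ∈ L ↔ f x ∈ L'

/-- NEXP-completeness (under polynomial-time many-one reductions). -/
def NEXPComplete (L : Language Bool) : Prop :=
  L ∈ NEXP ∧ ∀ L' ∈ NEXP, PolyTimeReducible L' L

/-! ### The tiling problem -/

/-- The fixed parameters of the tiling problem: a finite set of tiles, the horizontal and the
vertical constraints, and the tile that must be placed in the four corners. -/
structure TilingSystem where
  /-- the tiles -/
  Tile : Type
  [finTile : Finite Tile]
  /-- `(s, t) ∈ H`: `s` may be placed immediately to the left of `t` -/
  H : Set (Tile × Tile)
  /-- `(s, t) ∈ V`: `s` may be placed immediately below `t` -/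
  V : Set (Tile × Tile)
  /-- the designated corner tile -/
  corner : Tile

namespace TilingSystem

variable (S : TilingSystem)

/-- `f` is a valid tiling of the `N × N` grid, where `f i j` is the tile in column `i`
(counted from the left) and row `j` (counted from the bottom). -/
structure IsValidTiling (N : ℕ) (f : Fin N → Fin N → S.Tile) : Prop where
  horizontal : ∀ i i' j : Fin N, (i' : ℕ) = i + 1 → (f i j, f i' j) ∈ S.H
  vertical : ∀ i j j' : Fin N, (j' : ℕ) = j + 1 → (f i j, f i j') ∈ S.V
  corners : ∀ i j : Fin N, ((i : ℕ) = 0 ∨ (i : ℕ) + 1 = N) → ((j : ℕ) = 0 ∨ (j : ℕ) + 1 = N) →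
    f i j = S.corner

/-- The tiling problem with parameters `S`, as a language: the binary representations (least
significant bit first, most significant bit `1`) of the positive integers `N` such that the
`N × N` grid has a valid tiling. -/
def TILING : Language Bool :=
  {w | ∃ N : ℕ, 0 < N ∧ w = Computability.encodeNat N ∧ ∃ f, S.IsValidTiling N f}

end TilingSystem

/-! Membership. A nondeterministic machine guesses the tiling row by row, keeping only the current
row on its tape. The first sweep also guesses the width `W`. Each sweep decrements a binary counter
that starts at `N`, and a mark moves one column to the right per row. In the row declared final the
counter must become 0 and the mark must stand in the last column, so there are `N` rows and `W = N`.
This takes `2 * N ^ 2` steps, and `N < 2 ^ |w|` (`acceptsWithin_of_mem_TILING`,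
`mem_TILING_of_acceptsWithin`).

Hardness. One fixed tile set has to serve every machine, so `N` must carry the transition table as
well as the input. The corner tile forces a border around an `n × n` picture with `n = N - 2`. A row
counter that decreases to 0 in the bottom row makes the top row display `n - 1` in binary, one digit
per column. These digits are read as a program, cut into blocks of some length `K`: block 0 is zero
and block 1 starts with 1, which reveals `K`; blocks 1 to 4 are tables; then come initial
conditions, zero padding and a leading 1.

The fixed tiles cannot hold a symbol of an arbitrary alphabet. Instead a `K × K` block of cells
represents a symbol by the offset of one marked column. The tables, repeated with period `K`, move
right by one cell per row, so that row `s` of a block shows entry `r - s` (mod `K`) in column `r`. A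
mark at offset `r` meets the moving diagonal in row `r` and sends a signal along that row; where the
signal meets the neighbouring mark `r'`, the table shows entry `r' - r`. Vertical neighbours are
treated alike, with a copy of the upper mark carried down. Thus every relation that depends only on
the difference of offsets is enforced locally (`exists_markArray`, conversely `isPicture_picture`).

The offsets `2 ^ j - 1` modulo `2 ^ (k + 1)` form a ruler: the difference of two distinct offsets
determines both. To keep neighbours distinct, the alphabet is doubled by a parity bit that
alternates as on a chessboard (`exists_coding`).

Finally, accepting computations are arrays over a finite alphabet with local constraints
(`acceptsWithin_of_isArray`, `AcceptsWithin.exists_isArray`). Polynomially many padding blocks make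
the array exponentially large, while the digits of `N` remain a word of polynomial length, which a
stack machine produces (`nonempty_computable`). -/

/-! ### Binary arithmetic -/

/-- The number with a given list of binary digits, least significant digit first. -/
def bitsVal : List Bool → ℕ
  | [] => 0
  | b :: l => b.toNat + 2 * bitsVal l

theorem bitsVal_lt (l : List Bool) : bitsVal l < 2 ^ l.length := by
  induction l with
  | nil => simp [bitsVal]
  | cons b l ih => cases b <;> simp [bitsVal, pow_succ] <;> omega

theorem two_pow_le_bitsVal (l : List Bool) : 2 ^ l.length ≤ bitsVal (l ++ [true]) := by
  induction l with
  | nil => simp [bitsVal]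
  | cons b l ih => cases b <;> simp [bitsVal, pow_succ] <;> omega

theorem testBit_bitsVal (l : List Bool) (i : ℕ) :
    (bitsVal l).testBit i = (l[i]?).getD false := by
  induction l generalizing i with
  | nil => simp [bitsVal]
  | cons b l ih =>
    cases i with
    | zero => cases b <;> simp [bitsVal, Nat.testBit_zero]
    | succ i =>
      have h : (b.toNat + 2 * bitsVal l) / 2 = bitsVal l := by cases b <;> simp <;> omega
      rw [bitsVal, Nat.testBit_succ, h, ih]
      simp

theorem bitsVal_encodePosNum (p : PosNum) : bitsVal (Computability.encodePosNum p) = (p : ℕ) := by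
  induction p with
  | one => rfl
  | bit1 p ih => simp [Computability.encodePosNum, bitsVal, ih, PosNum.cast_bit1]; ring
  | bit0 p ih => simp [Computability.encodePosNum, bitsVal, ih, PosNum.cast_bit0]; ring

theorem bitsVal_encodeNat (n : ℕ) : bitsVal (Computability.encodeNat n) = n := by
  conv_rhs => rw [← Num.to_of_nat n]
  rw [Computability.encodeNat]
  rcases (n : Num) with _ | p
  · rfl
  · exact bitsVal_encodePosNum p

theorem encodePosNum_eq_append (p : PosNum) :
    ∃ l, Computability.encodePosNum p = l ++ [true] := by
  induction p with
  | one => exact ⟨[], rfl⟩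
  | bit1 p ih => obtain ⟨l, hl⟩ := ih; exact ⟨true :: l, by simp [Computability.encodePosNum, hl]⟩
  | bit0 p ih => obtain ⟨l, hl⟩ := ih; exact ⟨false :: l, by simp [Computability.encodePosNum, hl]⟩

theorem encodeNat_eq_append {n : ℕ} (hn : 0 < n) :
    ∃ l, Computability.encodeNat n = l ++ [true] := by
  have h : bitsVal (Computability.encodeNat n) = n := bitsVal_encodeNat n
  unfold Computability.encodeNat at h ⊢
  generalize (n : Num) = m at h ⊢
  rcases m with _ | p
  · have h : (0 : ℕ) = n := h
    omega
  · exact encodePosNum_eq_append p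

theorem bitsVal_append_true_injective :
    ∀ l l' : List Bool, bitsVal (l ++ [true]) = bitsVal (l' ++ [true]) → l = l'
  | [], [] => fun _ => rfl
  | [], b :: l' => fun h => by
    have := two_pow_le_bitsVal l'
    have := Nat.one_le_two_pow (n := l'.length)
    cases b <;> (simp [bitsVal] at h; omega)
  | b :: l, [] => fun h => by
    have := two_pow_le_bitsVal l
    have := Nat.one_le_two_pow (n := l.length)
    cases b <;> simp [bitsVal] at h <;> omega
  | b :: l, b' :: l' => fun h => by
    have ih := bitsVal_append_true_injective l l'
    cases b <;> cases b' <;> simp [bitsVal] at h ⊢ <;> first | exact ih (by omega) | omega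

/-- The binary representations of positive numbers are the lists of digits ending in `1`. -/
theorem pos_and_eq_encodeNat_iff (w : List Bool) (n : ℕ) :
    (0 < n ∧ w = Computability.encodeNat n) ↔ (∃ l, w = l ++ [true]) ∧ n = bitsVal w := by
  constructor
  · rintro ⟨hn, rfl⟩
    exact ⟨encodeNat_eq_append hn, (bitsVal_encodeNat n).symm⟩
  · rintro ⟨⟨l, rfl⟩, rfl⟩
    have hpos : 0 < bitsVal (l ++ [true]) := (Nat.two_pow_pos _).trans_le (two_pow_le_bitsVal l)
    refine ⟨hpos, ?_⟩
    obtain ⟨l', hl'⟩ := encodeNat_eq_append hpos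
    have h := bitsVal_encodeNat (bitsVal (l ++ [true]))
    rw [hl'] at h ⊢
    rw [bitsVal_append_true_injective _ _ h]

/-- Propagation of the borrow when `v` is decremented: a borrow reaches digit `i` exactly when all
lower digits are 0. -/
theorem decide_mod_two_pow_succ (v i : ℕ) :
    decide (v % 2 ^ (i + 1) = 0) = (decide (v % 2 ^ i = 0) && !v.testBit i) := by
  rw [Nat.mod_pow_succ, Nat.testBit_eq_decide_div_mod_eq]
  rcases Nat.mod_two_eq_zero_or_one (v / 2 ^ i) with h | h <;> simp [h]

/-- Decrementing flips exactly the digits reached by the borrow. Tiles and verifier both implement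
their counters by this rule. -/
theorem testBit_eq_xor_succ (v i : ℕ) :
    v.testBit i = ((v + 1).testBit i ^^ decide ((v + 1) % 2 ^ i = 0)) := by
  induction i generalizing v with
  | zero =>
    simp only [Nat.testBit_zero, pow_zero, Nat.mod_one, decide_true]
    rcases Nat.mod_two_eq_zero_or_one v with h | h <;> simp [Nat.add_mod, h]
  | succ i ih =>
    rw [Nat.testBit_succ, Nat.testBit_succ]
    rcases Nat.even_or_odd' v with ⟨u, rfl | rfl⟩
    · have h1 : (2 * u + 1) % 2 ^ (i + 1) ≠ 0 := by
        intro h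
        have := Nat.dvd_of_mod_eq_zero h
        have := (dvd_pow_self 2 (Nat.succ_ne_zero i)).trans this
        omega
      have h2 : (2 * u + 1) / 2 = u := by omega
      have h3 : 2 * u / 2 = u := by omega
      simp [h1, h2, h3]
    · have h1 : (2 * u + 1 + 1) / 2 = u + 1 := by omega
      have h2 : (2 * u + 1) / 2 = u := by omega
      have h3 : (2 * u + 1 + 1) % 2 ^ (i + 1) = 2 * ((u + 1) % 2 ^ i) := by
        rw [pow_succ', show 2 * u + 1 + 1 = 2 * (u + 1) by ring, Nat.mul_mod_mul_left]
      rw [h1, h2, h3, ih]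
      simp

/-! ### A ruler with distinct differences -/

/-- Uniqueness of binary expansions, for the equation `2 ^ b - 2 ^ a = 2 ^ d - 2 ^ c` with negative
terms moved across. A sum of two equal powers has a single binary digit 1, so it cannot equal a sum
of two distinct ones. -/
theorem two_pow_add_two_pow_inj {a b c d : ℕ} (hab : a ≠ b) (hcd : c ≠ d)
    (h : 2 ^ b + 2 ^ c = 2 ^ d + 2 ^ a) : a = c ∧ b = d := by
  have inj := Finset.geomSum_injective (n := 2) le_rfl
  have pair : ∀ {x y : ℕ}, x ≠ y → ∑ i ∈ ({x, y} : Finset ℕ), 2 ^ i = 2 ^ x + 2 ^ y :=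
    fun h => Finset.sum_pair h
  have single : ∀ x : ℕ, ∑ i ∈ ({x + 1} : Finset ℕ), 2 ^ i = 2 ^ x + 2 ^ x := fun x => by
    rw [Finset.sum_singleton]; ring
  have key : ∀ {x y z : ℕ}, x ≠ y → 2 ^ x + 2 ^ y = 2 ^ z + 2 ^ z → False := by
    intro x y z hxy h
    rw [← pair hxy, ← single] at h
    have := congrArg Finset.card (inj h)
    simp [Finset.card_pair hxy] at this
  by_cases hbc : b = c
  · by_cases hda : d = a
    · subst hbc hda
      have : 2 ^ (b + 1) = 2 ^ (d + 1) := by rw [pow_succ, pow_succ]; omega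
      have := Nat.pow_right_injective le_rfl this
      omega
    · subst hbc; exact (key hda h.symm).elim
  · by_cases hda : d = a
    · subst hda; exact (key hbc h).elim
    · rw [← pair hbc, ← pair hda] at h
      have h := inj h
      have hb : b ∈ ({d, a} : Finset ℕ) := h ▸ by simp
      have hc : c ∈ ({d, a} : Finset ℕ) := h ▸ by simp
      simp at hb hc
      omega

/-- The position of mark `r'` relative to mark `r` on a circle of length `K`. -/
def circDiff (K r r' : ℕ) : ℕ := (r' + (K - 1) * r) % K

theorem circDiff_lt {K : ℕ} (hK : 0 < K) (r r' : ℕ) : circDiff K r r' < K := Nat.mod_lt _ hK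

/-- The factor `K - 1` acts as `-1` modulo `K`, which avoids truncated subtraction. -/
theorem circDiff_modEq {K : ℕ} (hK : 0 < K) (r r' : ℕ) :
    (circDiff K r r' : ℤ) ≡ r' - r [ZMOD K] := by
  obtain ⟨K, rfl⟩ : ∃ m, K = m + 1 := ⟨K - 1, by omega⟩
  refine Int.ModEq.symm ((Int.modEq_iff_dvd).2 ?_)
  unfold circDiff
  rw [Int.natCast_mod, Int.emod_def]
  push_cast
  refine ⟨r - (r' + K * r) / (K + 1), ?_⟩
  ring

theorem circDiff_eq_iff {K : ℕ} (hK : 0 < K) {r r' s s' : ℕ} :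
    circDiff K r r' = circDiff K s s' ↔ (r' - r : ℤ) ≡ s' - s [ZMOD K] := by
  constructor
  · intro h
    exact (circDiff_modEq hK r r').symm.trans (h ▸ circDiff_modEq hK s s')
  · intro h
    have h := ((circDiff_modEq hK r r').trans h).trans (circDiff_modEq hK s s').symm
    have h := Int.natCast_modEq_iff.1 h
    exact Nat.ModEq.eq_of_lt_of_lt h (circDiff_lt hK _ _) (circDiff_lt hK _ _)

/-- Two differences of marks lie strictly between `-2 ^ k` and `2 ^ k`, so they are equal once they
agree modulo `2 ^ (k + 1)`. -/
theorem circDiff_two_pow_inj {k a b c d : ℕ} (ha : a < k) (hb : b < k) (hc : c < k) (hd : d < k)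
    (hab : a ≠ b) (hcd : c ≠ d)
    (h : circDiff (2 ^ (k + 1)) (2 ^ a - 1) (2 ^ b - 1) =
      circDiff (2 ^ (k + 1)) (2 ^ c - 1) (2 ^ d - 1)) : a = c ∧ b = d := by
  rw [circDiff_eq_iff (Nat.two_pow_pos _)] at h
  have lt : ∀ {x}, x < k → 1 ≤ 2 ^ x ∧ 2 ^ x < 2 ^ k := fun hx =>
    ⟨Nat.one_le_two_pow, Nat.pow_lt_pow_right (by norm_num) hx⟩
  have h1 := lt ha
  have h2 := lt hb
  have h3 := lt hc
  have h4 := lt hd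
  refine two_pow_add_two_pow_inj hab hcd ?_
  obtain ⟨e, he⟩ := (Int.modEq_iff_dvd).1 h
  have hK : ((2 ^ (k + 1) : ℕ) : ℤ) = 2 * (2 ^ k : ℕ) := by push_cast; ring
  rw [hK] at he
  generalize 2 ^ a = a' at *
  generalize 2 ^ b = b' at *
  generalize 2 ^ c = c' at *
  generalize 2 ^ d = d' at *
  generalize 2 ^ k = k' at *
  have he0 : e = 0 := by
    by_contra hne
    rcases lt_or_gt_of_ne hne with h' | h'
    · have : 2 * (k' : ℤ) * e ≤ 2 * (k' : ℤ) * (-1) := by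
        apply mul_le_mul_of_nonneg_left <;> omega
      omega
    · have : 2 * (k' : ℤ) * 1 ≤ 2 * (k' : ℤ) * e := by
        apply mul_le_mul_of_nonneg_left <;> omega
      omega
  subst he0
  omega

/-! ### Polynomial bounds -/

/-- A bound of this shape is what the padding machine can produce exactly: a unary counter of `n +
c` marks, iterated `d` times. -/
theorem exists_eval_le_pow (p : Polynomial ℕ) : ∃ c d : ℕ, ∀ n, p.eval n ≤ (n + c) ^ d := by
  induction p using Polynomial.induction_on' with
  | add p q hp hq =>
    obtain ⟨c, d, h⟩ := hp
    obtain ⟨c', d', h'⟩ := hq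
    refine ⟨c + c' + 2, d + d' + 1, fun n => ?_⟩
    rw [Polynomial.eval_add]
    have hb : 1 ≤ n + (c + c' + 2) := by omega
    have h1 : (n + c) ^ d ≤ (n + (c + c' + 2)) ^ (d + d') :=
      (Nat.pow_le_pow_left (by omega) d).trans (Nat.pow_le_pow_right hb (by omega))
    have h2 : (n + c') ^ d' ≤ (n + (c + c' + 2)) ^ (d + d') :=
      (Nat.pow_le_pow_left (by omega) d').trans (Nat.pow_le_pow_right hb (by omega))
    calc p.eval n + q.eval n ≤ (n + (c + c' + 2)) ^ (d + d') * 2 := by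
          have := h n; have := h' n; omega
      _ ≤ _ := by rw [pow_succ]; exact Nat.mul_le_mul_left _ (by omega)
  | monomial k a =>
    refine ⟨a, k + 1, fun n => ?_⟩
    rw [Polynomial.eval_monomial, pow_succ']
    exact Nat.mul_le_mul (by omega) (Nat.pow_le_pow_left (by omega) k)

/-! ### Picture systems with boundary conditions -/

/-- Local constraints for pictures: square arrays of cells whose columns are counted from the left
and whose rows are counted from the top, with conditions on the left, top and bottom boundary. -/
structure PictureSystem where
  /-- the cells -/
  Cell : Type
  [finCell : Finite Cell]
  /-- the relation between a cell and its right neighbour -/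
  H : Cell → Cell → Prop
  /-- the relation between a cell and its lower neighbour -/
  V : Cell → Cell → Prop
  /-- the cells allowed in the left column -/
  left : Cell → Prop
  /-- the cells allowed in the top row -/
  top : Cell → Prop
  /-- the cells allowed in the bottom row -/
  bottom : Cell → Prop

namespace PictureSystem

variable (P : PictureSystem)

/-- The cells `g i y` with `i, y < n` form a picture. -/
structure IsPicture (n : ℕ) (g : ℕ → ℕ → P.Cell) : Prop where
  horizontal : ∀ i y, i + 1 < n → y < n → P.H (g i y) (g (i + 1) y)
  vertical : ∀ i y, i < n → y + 1 < n → P.V (g i y) (g i (y + 1))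
  left : ∀ y < n, P.left (g 0 y)
  top : ∀ i < n, P.top (g i 0)
  bottom : ∀ i < n, P.bottom (g i (n - 1))

/-- Cells surrounded by a border. -/
inductive Bordered (C : Type) : Type
  | corner | left | right | bot | top
  | inner (c : C)

namespace Bordered

instance (C : Type) [Finite C] : Finite (Bordered C) := by
  refine Finite.of_surjective (α := Fin 5 ⊕ C)
    (Sum.elim ![corner, left, right, bot, top] inner) ?_
  rintro (_ | _ | _ | _ | _ | c)
  exacts [⟨.inl 0, rfl⟩, ⟨.inl 1, rfl⟩, ⟨.inl 2, rfl⟩, ⟨.inl 3, rfl⟩, ⟨.inl 4, rfl⟩, ⟨.inr c, rfl⟩]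

end Bordered

/-- Admissible horizontal neighbours in a bordered picture. -/
def BorderedH : Bordered P.Cell → Bordered P.Cell → Prop
  | .corner, .bot | .corner, .top | .bot, .bot | .bot, .corner | .top, .top | .top, .corner => True
  | .left, .inner c => P.left c
  | .inner c, .inner c' => P.H c c'
  | .inner _, .right => True
  | _, _ => False

/-- Admissible vertical neighbours in a bordered picture, the lower one first. -/
def BorderedV : Bordered P.Cell → Bordered P.Cell → Prop
  | .corner, .left | .corner, .right | .left, .left | .left, .corner | .right, .right
  | .right, .corner => True
  | .bot, .inner c => P.bottom c
  | .inner c, .inner c' => P.V c' c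
  | .inner c, .top => P.top c
  | _, _ => False

/-- The tiling system whose tilings are the bordered pictures. -/
def toTilingSystem : TilingSystem where
  Tile := Bordered P.Cell
  finTile := haveI := P.finCell; inferInstance
  H := {x | P.BorderedH x.1 x.2}
  V := {x | P.BorderedV x.1 x.2}
  corner := .corner

/-- The prescribed corners start the border. It cannot break off early: `.left` admits no left
neighbour, `.right` no right neighbour, `.bot` nothing below and `.top` nothing above, and a corner
in mid-border would put one of these where such a neighbour exists. -/
theorem exists_isPicture_of_isValidTiling {n : ℕ}
    {f : Fin (n + 2) → Fin (n + 2) → Bordered P.Cell} (hn : 0 < n)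
    (hf : P.toTilingSystem.IsValidTiling (n + 2) f) : ∃ g, P.IsPicture n g := by
  let F : ℕ → ℕ → Bordered P.Cell := fun i j =>
    if h : i < n + 2 ∧ j < n + 2 then f ⟨i, h.1⟩ ⟨j, h.2⟩ else .corner
  have hFf : ∀ {i j} (hi : i < n + 2) (hj : j < n + 2), F i j = f ⟨i, hi⟩ ⟨j, hj⟩ :=
    fun hi hj => dif_pos ⟨hi, hj⟩
  have hH : ∀ i j, i < n + 1 → j < n + 2 → P.BorderedH (F i j) (F (i + 1) j) := by
    intro i j hi hj
    have h := hf.horizontal ⟨i, by omega⟩ ⟨i + 1, by omega⟩ ⟨j, hj⟩ rfl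
    rw [hFf (by omega) hj, hFf (by omega) hj]
    exact h
  have hV : ∀ i j, i < n + 2 → j < n + 1 → P.BorderedV (F i j) (F i (j + 1)) := by
    intro i j hi hj
    have h := hf.vertical ⟨i, hi⟩ ⟨j, by omega⟩ ⟨j + 1, by omega⟩ rfl
    rw [hFf hi (by omega), hFf hi (by omega)]
    exact h
  have hc : ∀ i j, (i = 0 ∨ i = n + 1) → (j = 0 ∨ j = n + 1) → F i j = .corner := by
    intro i j hi hj
    have hi' : i < n + 2 := by omega
    have hj' : j < n + 2 := by omega
    have h := hf.corners ⟨i, hi'⟩ ⟨j, hj'⟩ (by simp; omega) (by simp; omega)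
    exact (hFf hi' hj').trans h
  clear hFf
  clear_value F
  have hbot : ∀ i, 0 < i → i < n + 1 → F i 0 = .bot := by
    intro i hi
    induction i, hi using Nat.le_induction with
    | base =>
      intro hi
      have h1 := hH 0 0 (by omega) (by omega)
      have h2 := hV 1 0 (by omega) (by omega)
      rw [hc 0 0 (by simp) (by simp)] at h1
      revert h1 h2
      generalize F 1 0 = x
      generalize F 1 1 = y
      cases x <;> cases y <;> simp [BorderedH, BorderedV]
    | succ i hi ih =>
      intro hi'
      have h1 := hH i 0 (by omega) (by omega)
      have h2 := hV (i + 1) 0 (by omega) (by omega)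
      have h3 := hH i 1 (by omega) (by omega)
      have h4 := hH (i + 1) 1 (by omega) (by omega)
      rw [ih (by omega)] at h1
      revert h1 h2 h3 h4
      generalize F (i + 1) 0 = x
      generalize F (i + 1) 1 = y
      generalize F i 1 = u
      generalize F (i + 1 + 1) 1 = v
      cases x <;> cases y <;> simp [BorderedH, BorderedV]
  have hleft : ∀ j, 0 < j → j < n + 1 → F 0 j = .left := by
    intro j hj
    induction j, hj using Nat.le_induction with
    | base =>
      intro hj
      have h1 := hV 0 0 (by omega) (by omega)
      have h2 := hH 0 1 (by omega) (by omega)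
      rw [hc 0 0 (by simp) (by simp)] at h1
      revert h1 h2
      generalize F 0 1 = x
      generalize F 1 1 = y
      cases x <;> cases y <;> simp [BorderedH, BorderedV]
    | succ j hj ih =>
      intro hj'
      have h1 := hV 0 j (by omega) (by omega)
      have h2 := hH 0 (j + 1) (by omega) (by omega)
      have h3 := hV 1 j (by omega) (by omega)
      have h4 := hV 1 (j + 1) (by omega) (by omega)
      rw [ih (by omega)] at h1
      revert h1 h2 h3 h4
      generalize F 0 (j + 1) = x
      generalize F 1 (j + 1) = y
      generalize F 1 j = u
      generalize F 1 (j + 1 + 1) = v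
      cases x <;> cases y <;> simp [BorderedH, BorderedV]
  have hinner : ∀ j, 0 < j → j < n + 1 → ∀ i, 0 < i → i < n + 1 → ∃ c, F i j = .inner c := by
    intro j hj hj' i hi
    induction i, hi using Nat.le_induction with
    | base =>
      intro _
      have h1 := hH 0 j (by omega) (by omega)
      rw [hleft j hj hj'] at h1
      revert h1
      generalize F (0 + 1) j = x
      cases x <;> simp [BorderedH]
    | succ i hi ih =>
      intro hi'
      obtain ⟨c, hc⟩ := ih (by omega)
      have h1 := hH i j (by omega) (by omega)
      have h2 := hH (i + 1) j (by omega) (by omega)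
      rw [hc] at h1
      revert h1 h2
      generalize F (i + 1) j = x
      generalize F (i + 1 + 1) j = y
      cases x <;> cases y <;> simp [BorderedH]
  have htop : ∀ i, 0 < i → i < n + 1 → F i (n + 1) = .top := by
    intro i hi
    induction i, hi using Nat.le_induction with
    | base =>
      intro hi
      have h1 := hH 0 (n + 1) (by omega) (by omega)
      have h2 := hV 1 n (by omega) (by omega)
      rw [hc 0 (n + 1) (by simp) (by simp)] at h1
      revert h1 h2
      generalize F 1 n = y
      generalize F (0 + 1) (n + 1) = x
      cases x <;> cases y <;> simp [BorderedH, BorderedV]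
    | succ i hi ih =>
      intro hi'
      have h1 := hH i (n + 1) (by omega) (by omega)
      have h2 := hV (i + 1) n (by omega) (by omega)
      rw [ih (by omega)] at h1
      obtain ⟨c, hc⟩ := hinner n hn (by omega) (i + 1) (by omega) (by omega)
      rw [hc] at h2
      revert h1 h2
      generalize F (i + 1) (n + 1) = x
      cases x <;> simp [BorderedH, BorderedV]
  have : Nonempty P.Cell := ⟨(hinner 1 one_pos (by omega) 1 one_pos (by omega)).choose⟩
  choose! c hc' using hinner
  -- Pictures count rows from the top and tilings from the bottom, hence the row `n - y`.
  have hF : ∀ i y, i < n → y < n → F (i + 1) (n - y) = .inner (c (n - y) (i + 1)) :=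
    fun i y hi hy => hc' _ (by omega) (by omega) _ (by omega) (by omega)
  refine ⟨fun i y => c (n - y) (i + 1), ?_, ?_, ?_, ?_, ?_⟩
  · intro i y hi hy
    have h := hH (i + 1) (n - y) (by omega) (by omega)
    rw [hF i y (by omega) hy, hF (i + 1) y hi hy] at h
    exact h
  · intro i y hi hy
    have h := hV (i + 1) (n - (y + 1)) (by omega) (by omega)
    rw [hF i (y + 1) hi hy, show n - (y + 1) + 1 = n - y by omega, hF i y hi (by omega)] at h
    exact h
  · intro y hy
    have h := hH 0 (n - y) (by omega) (by omega)
    rw [hleft _ (by omega) (by omega), hF 0 y hn hy] at h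
    exact h
  · intro i hi
    have h := hV (i + 1) n (by omega) (by omega)
    rw [htop _ (by omega) (by omega), ← Nat.sub_zero n, hF i 0 hi hn] at h
    exact h
  · intro i hi
    have h := hV (i + 1) 0 (by omega) (by omega)
    rw [hbot _ (by omega) (by omega), show 0 + 1 = n - (n - 1) by omega,
      hF i (n - 1) hi (by omega)] at h
    exact h

theorem exists_isValidTiling_of_isPicture {n : ℕ} {g} (hn : 0 < n) (hg : P.IsPicture n g) :
    ∃ f, P.toTilingSystem.IsValidTiling (n + 2) f := by
  let F : ℕ → ℕ → Bordered P.Cell := fun i j =>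
    if i = 0 then (if j = 0 ∨ j = n + 1 then .corner else .left)
    else if i = n + 1 then (if j = 0 ∨ j = n + 1 then .corner else .right)
    else if j = 0 then .bot else if j = n + 1 then .top else .inner (g (i - 1) (n - j))
  refine ⟨fun i j => F i j, ?_, ?_, ?_⟩
  · rintro ⟨i, hi⟩ ⟨i', hi'⟩ ⟨j, hj⟩ h
    obtain rfl : i' = i + 1 := h
    change P.BorderedH (F i j) (F (i + 1) j)
    by_cases hj0 : j = 0
    · subst hj0
      by_cases h0 : i = 0 <;> by_cases h1 : i = n <;> by_cases h2 : i = n + 1 <;>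
        first | omega | simp [F, h0, h1, h2, BorderedH, hn.ne']
    by_cases hj1 : j = n + 1
    · subst hj1
      by_cases h0 : i = 0 <;> by_cases h1 : i = n <;> by_cases h2 : i = n + 1 <;>
        first | omega | simp [F, h0, h1, h2, BorderedH, hn.ne']
    rcases Nat.eq_zero_or_pos i with rfl | h0
    · simpa [F, hj0, hj1, BorderedH, hn.ne, hn.ne'] using hg.left (n - j) (by omega)
    · have h0' : i ≠ 0 := by omega
      have h2 : i ≠ n + 1 := by omega
      by_cases h1 : i = n
      · simp [F, h1, hj0, hj1, BorderedH, hn.ne']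
      · have := hg.horizontal (i - 1) (n - j) (by omega) (by omega)
        rw [show i - 1 + 1 = i by omega] at this
        simpa [F, h0', h1, h2, hj0, hj1, BorderedH] using this
  · rintro ⟨i, hi⟩ ⟨j, hj⟩ ⟨j', hj'⟩ h
    obtain rfl : j' = j + 1 := h
    change P.BorderedV (F i j) (F i (j + 1))
    by_cases hi0 : i = 0
    · subst hi0
      by_cases h0 : j = 0 <;> by_cases h1 : j = n <;> by_cases h2 : j = n + 1 <;>
        first | omega | simp [F, h0, h1, h2, BorderedV, hn.ne']
    by_cases hi1 : i = n + 1
    · subst hi1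
      by_cases h0 : j = 0 <;> by_cases h1 : j = n <;> by_cases h2 : j = n + 1 <;>
        first | omega | simp [F, h0, h1, h2, BorderedV, hn.ne']
    rcases Nat.eq_zero_or_pos j with rfl | h0
    · simpa [F, hi0, hi1, BorderedV, hn.ne, hn.ne'] using hg.bottom (i - 1) (by omega)
    · have h0' : j ≠ 0 := by omega
      have h2 : j ≠ n + 1 := by omega
      by_cases h1 : j = n
      · simpa [F, h0', h1, h2, hi0, hi1, hn.ne', BorderedV] using hg.top (i - 1) (by omega)
      · have := hg.vertical (i - 1) (n - (j + 1)) (by omega) (by omega)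
        rw [show n - (j + 1) + 1 = n - j by omega] at this
        simpa [F, h0', h1, h2, hi0, hi1, BorderedV] using this
  · rintro ⟨i, hi⟩ ⟨j, hj⟩ h1 h2
    change F i j = .corner
    have h2' : j = 0 ∨ j = n + 1 := by simpa using h2
    have h1' : i = 0 ∨ i = n + 1 := by simpa using h1
    rcases h1' with rfl | rfl <;> simp [F, h2']

end PictureSystem

/-! ### A universal picture system -/

/-- The cells of the universal picture system. -/
@[ext] structure UCell where
  /-- digit of the row counter -/
  dig : Bool
  /-- borrow when the row counter is decremented -/
  borrow : Bool
  /-- input bit of the column -/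
  bit : Bool
  /-- the periodic patterns: marks of the block starts, and four tables -/
  stat : Fin 5 → Bool
  /-- the patterns, shifted right by one in every row -/
  pat : Fin 5 → Bool
  /-- the shifted patterns of the left neighbour -/
  patl : Fin 5 → Bool
  /-- whether a block of rows starts here -/
  row : Bool
  /-- the index of the block of columns, at most 5 -/
  blk : Fin 6
  /-- the index of the block of rows, at most 5 -/
  rblk : Fin 6
  /-- whether this column holds the mark of this block -/
  new : Bool
  /-- whether this column holds the mark of the block above -/
  old : Bool
  /-- whether the mark of this block is in this column or further left -/
  seen : Bool
  /-- whether this row is the one that signals the mark of this block to the right -/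
  sendH : Bool
  /-- whether this row is the one that signals the mark of the block on the left -/
  recvH : Bool
  /-- whether this row is the one that signals the mark of the block above -/
  recvV : Bool

namespace UCell

instance : Finite UCell := by
  let e : UCell → (Bool × Bool × Bool) × ((Fin 5 → Bool) × (Fin 5 → Bool) × (Fin 5 → Bool)) ×
      (Bool × Fin 6 × Fin 6) × (Bool × Bool × Bool) × (Bool × Bool × Bool) := fun c =>
    ((c.dig, c.borrow, c.bit), (c.stat, c.pat, c.patl), (c.row, c.blk, c.rblk),
      (c.new, c.old, c.seen), (c.sendH, c.recvH, c.recvV))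
  refine Finite.of_injective e fun c c' h => ?_
  simp only [e, Prod.mk.injEq] at h
  ext1 <;> tauto

/-- The next block index, at most 5. -/
def next (b : Fin 6) : Fin 6 := ⟨min (b.val + 1) 5, by omega⟩

/-- The constraints on a single cell. -/
structure Ok (c : UCell) : Prop where
  row : c.row = true → c.pat = c.stat
  start : c.stat 0 = true → c.pat 0 = c.row
  table : ∀ k : Fin 5, k ≠ 0 → c.blk.val = k.val → c.stat k = c.bit
  new : c.new = true → c.stat 1 = true
  recvH : c.recvH = true → c.new = true → c.pat 2 = true
  recvV : c.recvV = true → c.new = true → c.pat 3 = true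
  sendH : c.new = true → c.pat 0 = true → c.sendH = true
  sendV : c.old = true → c.pat 0 = true → c.recvV = true

/-- The constraints on a cell and its right neighbour. -/
structure HRel (l c : UCell) : Prop where
  ok : c.Ok
  borrow : c.borrow = (l.borrow && !l.dig)
  row : c.row = l.row
  patl : c.patl = l.pat
  blk : c.blk = if c.stat 0 then next l.blk else l.blk
  first : l.blk = 0 → c.stat 0 = c.bit
  seen : c.seen = true → c.new = true ∨ c.stat 0 = false ∧ l.seen = true
  complete : c.stat 0 = true → l.blk = 5 → l.rblk = 5 → l.seen = true
  same : c.stat 0 = false → c.sendH = l.sendH ∧ c.recvH = l.recvH ∧ c.recvV = l.recvV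
  pass : c.stat 0 = true → c.recvH = l.sendH

/-- The constraints on a cell and its lower neighbour. -/
structure VRel (u c : UCell) : Prop where
  dig : c.dig = (u.dig ^^ u.borrow)
  bit : c.bit = u.bit
  stat : c.stat = u.stat
  pat : c.pat = u.patl
  rblk : c.rblk = if c.row then next u.rblk else u.rblk
  same : c.row = false → c.new = u.new ∧ c.old = u.old
  old : c.row = true → c.old = u.new
  init : c.row = true → u.rblk = 4 → c.new = true → c.bit = false

end UCell

/-- The universal picture system. -/
def universalSystem : PictureSystem where
  Cell := UCell
  H := UCell.HRel
  V := UCell.VRel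
  left c := c.Ok ∧ c.stat 0 = true ∧ c.blk = 0 ∧ c.borrow = true
  top c := c.row = true ∧ c.bit = c.dig ∧ c.rblk = 0
  bottom c := c.dig = false ∧ (c.old = true → c.stat 4 = true)

/-- The bit in position `r` of block `k` of the binary representation of `m`, for blocks of
length `K`. -/
def blockBit (m K k r : ℕ) : Bool := m.testBit (k * K + r)

/-! ### The structure forced on every picture: counter, block length, periodic patterns -/

namespace universalSystem

variable {n K : ℕ} {g : ℕ → ℕ → UCell}

/-- The counter is determined from the bottom row upwards: `v` rows above it the digits are those of
`v`. The outer induction is on this height, the inner one follows the borrow along the row. -/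
theorem dig_eq (hg : universalSystem.IsPicture n g) (v : ℕ) :
    ∀ y, y + v + 1 = n → ∀ i < n, (g i y).dig = v.testBit i := by
  induction v with
  | zero =>
    intro y hy i hi
    have h := (hg.bottom i hi).1
    rw [show n - 1 = y by omega] at h
    simpa using h
  | succ v ih =>
    intro y hy i
    have key : i < n → (g i y).borrow = decide ((v + 1) % 2 ^ i = 0) ∧
        (g i y).dig = (v + 1).testBit i := by
      induction i with
      | zero =>
        intro hi
        have h1 : (g 0 y).borrow = true := (hg.left y (by omega)).2.2.2
        have h2 := (hg.vertical 0 y hi (by omega)).dig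
        rw [ih (y + 1) (by omega) 0 hi, testBit_eq_xor_succ, h1] at h2
        refine ⟨by simp [h1, Nat.mod_one], ?_⟩
        simpa [Nat.mod_one] using h2.symm
      | succ i ih' =>
        intro hi
        obtain ⟨h3, h4⟩ := ih' (by omega)
        have h1 := (hg.horizontal i y hi (by omega)).borrow
        rw [h3, h4, ← decide_mod_two_pow_succ] at h1
        have h2 := (hg.vertical (i + 1) y hi (by omega)).dig
        rw [ih (y + 1) (by omega) _ hi, testBit_eq_xor_succ, h1] at h2
        exact ⟨h1, (Bool.xor_left_inj.1 h2).symm⟩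
    exact fun hi => (key hi).2

theorem ok (hg : universalSystem.IsPicture n g) {i y : ℕ} (hi : i < n) (hy : y < n) :
    (g i y).Ok := by
  rcases i with _ | i
  · exact (hg.left y hy).1
  · exact (hg.horizontal i y hi hy).ok

theorem stat_eq (hg : universalSystem.IsPicture n g) {i y : ℕ} (hi : i < n) (hy : y < n) :
    (g i y).stat = (g i 0).stat := by
  induction y with
  | zero => rfl
  | succ y ih => rw [(hg.vertical i y hi hy).stat, ih (by omega)]

theorem bit_eq (hg : universalSystem.IsPicture n g) {i y : ℕ} (hi : i < n) (hy : y < n) :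
    (g i y).bit = (n - 1).testBit i := by
  induction y with
  | zero => rw [(hg.top i hi).2.1, dig_eq hg (n - 1) 0 (by omega) i hi]
  | succ y ih => rw [(hg.vertical i y hi hy).bit, ih (by omega)]

theorem row_eq (hg : universalSystem.IsPicture n g) {i y : ℕ} (hi : i < n) (hy : y < n) :
    (g i y).row = (g 0 y).row := by
  induction i with
  | zero => rfl
  | succ i ih => rw [(hg.horizontal i y hi hy).row, ih (by omega)]

/-- Patterns travel along diagonals, since each cell passes its pattern to its lower right neighbour
through `patl`. -/
theorem pat_add (hg : universalSystem.IsPicture n g) {i y d : ℕ} (hi : i + d < n)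
    (hy : y + d < n) : (g (i + d) (y + d)).pat = (g i y).pat := by
  induction d with
  | zero => rfl
  | succ d ih =>
    rw [← ih (by omega) (by omega), ← (hg.horizontal (i + d) (y + d) hi (by omega)).patl]
    exact (hg.vertical (i + d + 1) (y + d) hi hy).pat

/-- The first block of the input marks the block length `K`. -/
structure BlockLength (m K : ℕ) : Prop where
  pos : 0 < K
  zero : ∀ i, 0 < i → i < K → m.testBit i = false
  one : m.testBit K = true

/-- Inside block 0 the constraint `first` starts a new block at the first digit 1 to the right of
column 0, and that is column `K`. -/
theorem stat_first (hg : universalSystem.IsPicture n g) (hK : BlockLength (n - 1) K) {i : ℕ}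
    (hi : i < n) (hiK : i ≤ K) :
    ((g i 0).stat 0 = true ↔ i = 0 ∨ i = K) ∧ (i < K → (g i 0).blk = 0) := by
  induction i with
  | zero => exact ⟨by simp [(hg.left 0 hi).2.1], fun _ => (hg.left 0 hi).2.2.1⟩
  | succ i ih =>
    have h0 := (ih (by omega) (by omega)).2 (by omega)
    have h := hg.horizontal i 0 hi (by omega)
    have h1 := h.first h0
    rw [bit_eq hg hi (by omega)] at h1
    rcases Nat.lt_or_ge (i + 1) K with hlt | hge
    · rw [hK.zero _ (by omega) hlt] at h1
      refine ⟨by simp [h1]; omega, fun _ => ?_⟩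
      rw [h.blk, h1, h0]
      rfl
    · obtain rfl : i + 1 = K := by omega
      rw [hK.one] at h1
      exact ⟨by simp [h1], by omega⟩

/-- The start mark of cell `(0, 0)` travels along the main diagonal; at `(y, y)` it identifies the
starts of row blocks with those of column blocks. -/
theorem row_first (hg : universalSystem.IsPicture n g) (hK : BlockLength (n - 1) K) {y : ℕ}
    (hy : y < n) (hyK : y ≤ K) : (g 0 y).row = true ↔ y = 0 ∨ y = K := by
  have h0 : (g 0 0).row = true := (hg.top 0 (by omega)).1
  have hd : (g y y).pat 0 = true := by
    have := pat_add hg (i := 0) (y := 0) (d := y) (by omega) (by omega)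
    rw [zero_add] at this
    rw [this, (ok hg (by omega) (by omega)).row h0]
    exact (hg.left 0 (by omega)).2.1
  have hs := (stat_first hg hK hy hyK).1
  rw [← stat_eq hg hy hy] at hs
  rw [← row_eq hg hy hy, ← hs]
  constructor
  · intro h
    rwa [← (ok hg hy hy).row h]
  · intro h
    rwa [← (ok hg hy hy).start h]

/-- Row 0 loads the patterns into the diagonals, and row `K` starts a block and compares them with
the columns `K` places further right. This makes the patterns periodic. -/
theorem stat_add (hg : universalSystem.IsPicture n g) (hK : BlockLength (n - 1) K) {i : ℕ}
    (hi : i + K < n) : (g (i + K) 0).stat = (g i 0).stat := by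
  have h1 : (g 0 K).row = true := (row_first hg hK (by omega) le_rfl).2 (Or.inr rfl)
  have h2 := (ok hg (i := i + K) (y := K) hi (by omega)).row
    (by rw [row_eq hg hi (by omega), h1])
  have h3 := pat_add hg (i := i) (y := 0) (d := K) hi (by omega)
  rw [zero_add] at h3
  rw [← stat_eq hg hi (y := K) (by omega), ← h2, h3, (ok hg (by omega) (by omega)).row]
  exact (hg.top i (by omega)).1

theorem stat_zero_zero (hg : universalSystem.IsPicture n g) {y : ℕ} (hy : y < n) :
    (g 0 y).stat 0 = true := (hg.left y hy).2.1

/-- Column 0 feeds the row starts into the diagonals, and column `K`, being a block start, compares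
them with its own rows. -/
theorem row_add (hg : universalSystem.IsPicture n g) (hK : BlockLength (n - 1) K) {y : ℕ}
    (hy : y + K < n) : (g 0 (y + K)).row = (g 0 y).row := by
  have hKn : K < n := by omega
  have h1 : (g K (y + K)).stat 0 = true := by
    rw [stat_eq hg hKn hy]
    exact (stat_first hg hK hKn le_rfl).1.2 (Or.inr rfl)
  have h2 := (ok hg hKn hy).start h1
  have h3 := pat_add hg (i := 0) (y := y) (d := K) (by omega) hy
  rw [zero_add] at h3
  rw [← row_eq hg hKn hy, ← h2, h3]
  exact (ok hg (by omega) (by omega)).start (stat_zero_zero hg (by omega))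

theorem stat_mod (hg : universalSystem.IsPicture n g) (hK : BlockLength (n - 1) K) {i : ℕ}
    (hi : i < n) : (g i 0).stat = (g (i % K) 0).stat := by
  induction i using Nat.strong_induction_on with
  | _ i ih =>
    rcases Nat.lt_or_ge i K with h | h
    · rw [Nat.mod_eq_of_lt h]
    · have := stat_add hg hK (i := i - K) (by omega)
      rw [Nat.sub_add_cancel h] at this
      have hpos := hK.pos
      rw [this, ih (i - K) (by omega) (by omega), Nat.mod_eq_sub_mod h]

theorem stat_zero_iff (hg : universalSystem.IsPicture n g) (hK : BlockLength (n - 1) K) {i y : ℕ}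
    (hi : i < n) (hy : y < n) : (g i y).stat 0 = true ↔ i % K = 0 := by
  have hlt := Nat.mod_lt i hK.pos
  have hle := Nat.mod_le i K
  rw [stat_eq hg hi hy, stat_mod hg hK hi, (stat_first hg hK (by omega) hlt.le).1]
  omega

theorem row_iff (hg : universalSystem.IsPicture n g) (hK : BlockLength (n - 1) K) {i y : ℕ}
    (hi : i < n) (hy : y < n) : (g i y).row = true ↔ y % K = 0 := by
  rw [row_eq hg hi hy]
  clear hi
  induction y using Nat.strong_induction_on with
  | _ y ih =>
    have hpos := hK.pos
    rcases Nat.lt_or_ge y K with h | h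
    · rw [Nat.mod_eq_of_lt h, row_first hg hK hy h.le]
      omega
    · have := row_add hg hK (y := y - K) (by omega)
      rw [Nat.sub_add_cancel h] at this
      rw [this, ih (y - K) (by omega) (by omega), Nat.mod_eq_sub_mod h]

theorem succ_div_mod (hK : 0 < K) (i : ℕ) :
    ((i + 1) % K = 0 ∧ (i + 1) / K = i / K + 1 ∧ i % K = K - 1) ∨
      ((i + 1) % K = i % K + 1 ∧ (i + 1) / K = i / K) := by
  have h1 := Nat.div_add_mod i K
  have h2 := Nat.mod_lt i hK
  rcases Nat.lt_or_ge (i % K + 1) K with h | h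
  · right
    have h3 : i + 1 = (i % K + 1) + K * (i / K) := by omega
    constructor
    · rw [h3, Nat.add_mul_mod_self_left, Nat.mod_eq_of_lt h]
    · rw [h3, Nat.add_mul_div_left _ _ hK, Nat.div_eq_of_lt h, zero_add]
  · left
    have h3 : i + 1 = K * (i / K + 1) := by rw [mul_add]; omega
    refine ⟨?_, ?_, by omega⟩
    · rw [h3, Nat.mul_mod_right]
    · rw [h3, Nat.mul_div_cancel_left _ hK]

theorem blk_val (hg : universalSystem.IsPicture n g) (hK : BlockLength (n - 1) K) {i y : ℕ}
    (hi : i < n) (hy : y < n) : (g i y).blk.val = min (i / K) 5 := by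
  induction i with
  | zero => simp [(hg.left y hy).2.2.1]
  | succ i ih =>
    have h := (hg.horizontal i y hi hy).blk
    have hs := stat_zero_iff hg hK hi hy
    have ih := ih (by omega)
    rcases succ_div_mod hK.pos i with ⟨h1, h2, -⟩ | ⟨h1, h2⟩
    · rw [if_pos (hs.2 h1)] at h
      rw [h, h2]
      simp only [UCell.next, ih]
      omega
    · rw [if_neg (by rw [hs]; omega)] at h
      rw [h, h2, ih]

theorem rblk_val (hg : universalSystem.IsPicture n g) (hK : BlockLength (n - 1) K) {i y : ℕ}
    (hi : i < n) (hy : y < n) : (g i y).rblk.val = min (y / K) 5 := by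
  induction y with
  | zero => simp [(hg.top i hi).2.2]
  | succ y ih =>
    have h := (hg.vertical i y hi hy).rblk
    have hs := row_iff hg hK hi hy
    have ih := ih (by omega)
    rcases succ_div_mod hK.pos y with ⟨h1, h2, -⟩ | ⟨h1, h2⟩
    · rw [if_pos (hs.2 h1)] at h
      rw [h, h2]
      simp only [UCell.next, ih]
      omega
    · rw [if_neg (by rw [hs]; omega)] at h
      rw [h, h2, ih]

/-- Follow the diagonal back to the last row that starts a block, where moving and static patterns
agree. With `K ≤ i` this diagonal does not leave the picture on the left. -/
theorem pat_eq (hg : universalSystem.IsPicture n g) (hK : BlockLength (n - 1) K) {i y : ℕ}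
    (hi : i < n) (hy : y < n) (hKi : K ≤ i) :
    (g i y).pat = (g (circDiff K (y % K) (i % K)) 0).stat := by
  have hlt := Nat.mod_lt y hK.pos
  have hle := Nat.mod_le y K
  have h1 := pat_add hg (i := i - y % K) (y := y - y % K) (d := y % K) (by omega) (by omega)
  rw [Nat.sub_add_cancel (by omega), Nat.sub_add_cancel hle] at h1
  have h2 : (y - y % K) % K = 0 := Nat.sub_mod_eq_zero_of_mod_eq (Nat.mod_mod _ _).symm
  have h3 : (((i - y % K) % K : ℕ) : ℤ) ≡ circDiff K (y % K) (i % K) [ZMOD K] := by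
    refine Int.ModEq.trans ?_ (circDiff_modEq hK.pos _ _).symm
    push_cast [show y % K ≤ i by omega]
    exact (Int.mod_modEq _ _).trans (Int.ModEq.sub_right _ (Int.mod_modEq _ _).symm)
  have h4 : (i - y % K) % K = circDiff K (y % K) (i % K) :=
    Nat.ModEq.eq_of_lt_of_lt (Int.natCast_modEq_iff.1 h3) (Nat.mod_lt _ hK.pos)
      (circDiff_lt hK.pos _ _)
  rw [h1, (ok hg (by omega) (by omega)).row ((row_iff hg hK (by omega) (by omega)).2 h2),
    stat_eq hg (by omega) (by omega), stat_mod hg hK (by omega), h4]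

/-- Pattern `k` is compared with the program only in block `k`; periodicity then makes table `k`
available in all blocks. -/
theorem stat_eq_blockBit (hg : universalSystem.IsPicture n g) (hK : BlockLength (n - 1) K)
    {r : ℕ} {k : Fin 5} (hk : k ≠ 0) (hr : r < K) (hn : 5 * K ≤ n) :
    (g r 0).stat k = blockBit (n - 1) K k r := by
  have h4 : k.val * K + r < n := by
    have : k.val * K ≤ 4 * K := Nat.mul_le_mul_right _ (by omega)
    omega
  have hm : (k.val * K + r) % K = r := by
    rw [add_comm, Nat.add_mul_mod_self_right, Nat.mod_eq_of_lt hr]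
  have hd : (k.val * K + r) / K = k.val := by
    rw [add_comm, Nat.add_mul_div_right _ _ hK.pos, Nat.div_eq_of_lt hr, zero_add]
  have h1 := (ok hg h4 (y := 0) (by omega)).table k hk
    (by rw [blk_val hg hK h4 (by omega), hd]; omega)
  rw [bit_eq hg h4 (by omega), stat_mod hg hK h4, hm] at h1
  exact h1

end universalSystem

theorem circDiff_eq_zero_iff {K : ℕ} (hK : 0 < K) {r r' : ℕ} :
    circDiff K r r' = 0 ↔ r % K = r' % K := by
  have h : circDiff K 0 0 = 0 := by simp [circDiff]
  rw [← h, circDiff_eq_iff hK, Int.modEq_iff_dvd]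
  simp only [Nat.cast_zero, sub_zero, zero_sub, neg_sub]
  rw [← Int.modEq_iff_dvd, Int.natCast_modEq_iff]
  exact eq_comm

theorem circDiff_mod_mod {K : ℕ} (hK : 0 < K) (r r' : ℕ) :
    circDiff K (r % K) (r' % K) = circDiff K r r' := by
  rw [circDiff_eq_iff hK]
  push_cast
  exact (Int.mod_modEq _ _).sub (Int.mod_modEq _ _)

theorem circDiff_succ_succ {K : ℕ} (hK : 0 < K) (r r' : ℕ) :
    circDiff K (r + 1) (r' + 1) = circDiff K r r' := by
  rw [circDiff_eq_iff hK]
  push_cast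
  rw [add_sub_add_right_eq_sub]

theorem circDiff_of_mod_eq_zero {K : ℕ} (hK : 0 < K) {r r' : ℕ} (hr : r % K = 0) :
    circDiff K r r' = r' % K := by
  rw [← circDiff_mod_mod hK, hr]
  simp [circDiff]

theorem mul_add_mod_div {K r : ℕ} (P : ℕ) (hr : r < K) :
    (P * K + r) % K = r ∧ (P * K + r) / K = P := by
  constructor
  · rw [add_comm, Nat.add_mul_mod_self_right, Nat.mod_eq_of_lt hr]
  · rw [add_comm, Nat.add_mul_div_right _ _ (by omega), Nat.div_eq_of_lt hr, zero_add]

/-- The array `r` of offsets is compatible, in its first `X` rows and columns, with the tables in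
the blocks 1 to 4 and with the initial conditions in the further blocks of the binary
representation of `m`, and row `W - 1` is final. -/
structure MarkArray (m K X W : ℕ) (r : ℕ → ℕ → ℕ) : Prop where
  lt : ∀ p t, p < X → t < X → r p t < K
  valid : ∀ p t, p < X → t < X → blockBit m K 1 (r p t) = true
  horizontal : ∀ p t, p + 1 < X → t < X → blockBit m K 2 (circDiff K (r p t) (r (p + 1) t)) = true
  vertical : ∀ p t, p < X → t + 1 < X → blockBit m K 3 (circDiff K (r p t) (r p (t + 1))) = true
  init : ∀ p, p < X → blockBit m K (5 + p) (r p 0) = false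
  final : ∀ p t, p < X → t < X → t + 1 = W → blockBit m K 4 (r p t) = true

/-! ### Reading an array of marks off a picture -/

namespace universalSystem

variable {n K : ℕ} {g : ℕ → ℕ → UCell}

theorem exists_new (hg : universalSystem.IsPicture n g) (hK : BlockLength (n - 1) K) {P y : ℕ}
    (hP : 5 ≤ P) (hPn : (P + 1) * K < n) (hy : y < n) (hyK : 5 ≤ y / K) :
    ∃ r < K, (g (P * K + r) y).new = true := by
  have hpos := hK.pos
  have hmul : (P + 1) * K = P * K + K := by ring
  have key : ∀ s < K, (g (P * K + s) y).seen = true → ∃ r < K, (g (P * K + r) y).new = true := by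
    intro s
    induction s with
    | zero =>
      intro _ h
      have hP0 : 0 < P * K := Nat.mul_pos (by omega) hpos
      have h1 := hg.horizontal (P * K - 1) y (by omega) hy
      rw [Nat.sub_add_cancel hP0] at h1
      rcases h1.seen h with h2 | ⟨h2, -⟩
      · exact ⟨0, hpos, h2⟩
      · rw [(stat_zero_iff hg hK (by omega) hy).2 (Nat.mul_mod_left P K)] at h2
        simp at h2
    | succ s ih =>
      intro hs h
      rcases (hg.horizontal (P * K + s) y (by omega) hy).seen h with h2 | ⟨-, h2⟩
      · exact ⟨s + 1, hs, h2⟩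
      · exact ih (by omega) h2
  -- The presence of a mark is only tested on entering the next block, so that block has to begin
  -- inside the picture.
  refine key (K - 1) (by omega) ?_
  have h := (hg.horizontal (P * K + (K - 1)) y (by omega) hy)
  have h1 := mul_add_mod_div P (show K - 1 < K by omega)
  refine h.complete ?_ ?_ ?_
  · rw [show P * K + (K - 1) + 1 = (P + 1) * K by omega]
    exact (stat_zero_iff hg hK (by omega) hy).2 (Nat.mul_mod_left _ K)
  · refine Fin.ext ?_
    rw [blk_val hg hK (by omega) hy, h1.2]
    simp [hP]
  · refine Fin.ext ?_
    rw [rblk_val hg hK (by omega) hy]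
    simp [hyK]

theorem new_old_eq (hg : universalSystem.IsPicture n g) (hK : BlockLength (n - 1) K) {i T s : ℕ}
    (hi : i < n) (hs : s < K) (hn : T * K + s < n) :
    (g i (T * K + s)).new = (g i (T * K)).new ∧ (g i (T * K + s)).old = (g i (T * K)).old := by
  induction s with
  | zero => exact ⟨rfl, rfl⟩
  | succ s ih =>
    have h := (hg.vertical i (T * K + s) hi hn).same (by
      rw [Bool.eq_false_iff, ne_eq, add_assoc, row_iff hg hK hi hn, (mul_add_mod_div T hs).1]
      omega)
    rw [← (ih (by omega) (by omega)).1, ← (ih (by omega) (by omega)).2]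
    exact h

theorem old_eq (hg : universalSystem.IsPicture n g) (hK : BlockLength (n - 1) K) {i T s : ℕ}
    (hi : i < n) (hs : s < K) (hn : (T + 1) * K + s < n) :
    (g i ((T + 1) * K + s)).old = (g i (T * K)).new := by
  have hpos := hK.pos
  have hmul : (T + 1) * K = T * K + (K - 1) + 1 := by
    rw [add_mul, one_mul]; omega
  rw [(new_old_eq hg hK hi hs hn).2,
    ← (new_old_eq hg hK hi (s := K - 1) (by omega) (by omega)).1, hmul]
  refine (hg.vertical i (T * K + (K - 1)) hi (by omega)).old ?_
  rw [← hmul, row_iff hg hK hi (by omega), Nat.mul_mod_left]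

theorem flags_eq (hg : universalSystem.IsPicture n g) (hK : BlockLength (n - 1) K) {P y s : ℕ}
    (hy : y < n) (hs : s < K) (hn : P * K + s < n) :
    (g (P * K + s) y).sendH = (g (P * K) y).sendH ∧
      (g (P * K + s) y).recvH = (g (P * K) y).recvH ∧
      (g (P * K + s) y).recvV = (g (P * K) y).recvV := by
  induction s with
  | zero => exact ⟨rfl, rfl, rfl⟩
  | succ s ih =>
    have ih := ih (by omega) (by omega)
    have h := (hg.horizontal (P * K + s) y hn hy).same (by
      rw [Bool.eq_false_iff, ne_eq, add_assoc, stat_zero_iff hg hK hn hy,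
        (mul_add_mod_div P hs).1]
      omega)
    rw [← ih.1, ← ih.2.1, ← ih.2.2]
    exact h

theorem recvH_eq (hg : universalSystem.IsPicture n g) (hK : BlockLength (n - 1) K) {P y : ℕ}
    (hy : y < n) (hn : (P + 1) * K < n) :
    (g ((P + 1) * K) y).recvH = (g (P * K) y).sendH := by
  have hpos := hK.pos
  have hmul : (P + 1) * K = P * K + (K - 1) + 1 := by
    rw [add_mul, one_mul]; omega
  rw [← (flags_eq hg hK hy (s := K - 1) (by omega) (by omega)).1, hmul]
  refine (hg.horizontal (P * K + (K - 1)) y (by omega) hy).pass ?_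
  rw [← hmul, stat_zero_iff hg hK (by omega) hy, Nat.mul_mod_left]

theorem pat_apply (hg : universalSystem.IsPicture n g) (hK : BlockLength (n - 1) K)
    {P T r s : ℕ} (hP : 0 < P) (hr : r < K) (hs : s < K) (hi : P * K + r < n)
    (hy : T * K + s < n) :
    (g (P * K + r) (T * K + s)).pat = (g (circDiff K s r) 0).stat := by
  have : 1 * K ≤ P * K := Nat.mul_le_mul_right _ hP
  rw [pat_eq hg hK hi hy (by omega), (mul_add_mod_div P hr).1, (mul_add_mod_div T hs).1]

/-- Pattern 0 only marks block starts, so the moving copy is the diagonal of each block. There a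
column offset is turned into a row offset. -/
theorem pat_zero_diag (hg : universalSystem.IsPicture n g) (hK : BlockLength (n - 1) K)
    {P T r : ℕ} (hP : 0 < P) (hr : r < K) (hi : P * K + r < n)
    (hy : T * K + r < n) : (g (P * K + r) (T * K + r)).pat 0 = true := by
  rw [pat_apply hg hK hP hr hr hi hy, (circDiff_eq_zero_iff hK.pos).2 rfl]
  exact stat_zero_zero hg (by omega)

theorem exists_markArray (hg : universalSystem.IsPicture n g) (hK : BlockLength (n - 1) K) :
    ∃ r, MarkArray (n - 1) K ((n - 1) / K - 5) ((n - 1) / K - 5) r := by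
  have hpos := hK.pos
  set W := (n - 1) / K - 5 with hW
  have hle : ∀ {p}, p < W → (5 + p + 1) * K ≤ n - 1 := fun {p} hp =>
    (Nat.mul_le_mul_right K (show 5 + p + 1 ≤ (n - 1) / K by omega)).trans (Nat.div_mul_le_self _ _)
  have hmul : ∀ p, (5 + p + 1) * K = (5 + p) * K + K := fun p => by ring
  have hK5 : ∀ p, 5 * K ≤ (5 + p) * K := fun p => Nat.mul_le_mul_right _ (by omega)
  have hex : ∀ p t, p < W → t < W → ∃ r < K, (g ((5 + p) * K + r) ((5 + t) * K)).new = true := by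
    intro p t hp ht
    have h1 := hle hp
    have h2 := hle ht
    have := hmul t
    refine exists_new hg hK (by omega) (by omega) (by omega) ?_
    rw [Nat.mul_div_cancel _ hpos]
    omega
  choose! r hr hnew using hex
  have hnew' : ∀ p t s, p < W → t < W → s < K →
      (g ((5 + p) * K + r p t) ((5 + t) * K + s)).new = true := by
    intro p t s hp ht hs
    have h1 := hle hp
    have h2 := hle ht
    have := hmul t
    have := hmul p
    have := hr p t hp ht
    rw [(new_old_eq hg hK (by omega) hs (by omega)).1]
    exact hnew p t hp ht
  have hbit : ∀ (k : Fin 5) s p, p < W → k ≠ 0 → s < K →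
      (g s 0).stat k = blockBit (n - 1) K k s := by
    intro k s p hp hk hs
    have h1 := hle hp
    have := hmul p
    have := hK5 p
    exact stat_eq_blockBit hg hK hk hs (by omega)
  refine ⟨r, hr, ?_, ?_, ?_, ?_, ?_⟩
  · intro p t hp ht
    have h1 := hle hp
    have h2 := hle ht
    have := hmul t
    have := hmul p
    have hr' := hr p t hp ht
    have h := (ok hg (i := (5 + p) * K + r p t) (y := (5 + t) * K) (by omega) (by omega)).new
      (hnew p t hp ht)
    rw [stat_eq hg (by omega) (by omega), stat_mod hg hK (by omega), (mul_add_mod_div _ hr').1,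
      hbit 1 _ p hp (by decide) hr'] at h
    exact h
  · intro p t hp ht
    have h1 := hle hp
    have h2 := hle ht
    have h3 := hmul t
    have h4 := hmul p
    have h5 := hmul (p + 1)
    have h6 : (5 + (p + 1)) * K = (5 + p + 1) * K := by ring
    have hr' := hr p t (by omega) ht
    have hr'' := hr (p + 1) t hp ht
    -- In row `r p t` the mark crosses the diagonal. The signal sent there reaches the mark of the
    -- next block, where table 2 shows the entry for the difference of the offsets.
    have hs := (ok hg (i := (5 + p) * K + r p t) (y := (5 + t) * K + r p t) (by omega)
      (by omega)).sendH (hnew' p t _ (by omega) ht hr')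
      (pat_zero_diag hg hK (by omega) hr' (by omega) (by omega))
    rw [(flags_eq hg hK (by omega) hr' (by omega)).1,
      ← recvH_eq hg hK (by omega) (by omega), ← h6,
      ← (flags_eq hg hK (by omega) hr'' (by omega)).2.1] at hs
    have h := (ok hg (i := (5 + (p + 1)) * K + r (p + 1) t) (y := (5 + t) * K + r p t) (by omega)
      (by omega)).recvH hs (hnew' (p + 1) t _ hp ht hr')
    rwa [pat_apply hg hK (by omega) hr'' hr' (by omega) (by omega),
      hbit 2 _ p (by omega) (by decide) (circDiff_lt hpos _ _)] at h
  · intro p t hp ht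
    have h1 := hle hp
    have h2 := hle ht
    have h3 := hmul t
    have h4 := hmul p
    have h5 := hmul (t + 1)
    have h6 : (5 + (t + 1)) * K = (5 + t + 1) * K := by ring
    have hr' := hr p t hp (by omega)
    have hr'' := hr p (t + 1) hp ht
    -- The same crossing inside the lower block, using the copy of the upper mark kept in `old`.
    have hs := (ok hg (i := (5 + p) * K + r p t) (y := (5 + t + 1) * K + r p t) (by omega)
      (by omega)).sendV
      (by rw [old_eq hg hK (by omega) hr' (by omega)]; exact hnew p t hp (by omega))
      (pat_zero_diag hg hK (by omega) hr' (by omega) (by omega))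
    rw [(flags_eq hg hK (by omega) hr' (by omega)).2.2, ← h6,
      ← (flags_eq hg hK (by omega) hr'' (by omega)).2.2] at hs
    have h := (ok hg (i := (5 + p) * K + r p (t + 1)) (y := (5 + (t + 1)) * K + r p t) (by omega)
      (by omega)).recvV hs (hnew' p (t + 1) _ hp ht hr')
    rwa [pat_apply hg hK (by omega) hr'' hr' (by omega) (by omega),
      hbit 3 _ p hp (by decide) (circDiff_lt hpos _ _)] at h
  · intro p hp
    have h1 := hle hp
    have h4 := hmul p
    have h5 := hK5 p
    have h0 := hr p 0 hp (by omega)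
    -- Initial conditions are tested between the last row of row block 4 and the first row of row
    -- block 5.
    have hv := hg.vertical ((5 + p) * K + r p 0) (5 * K - 1) (by omega) (by omega)
    rw [show 5 * K - 1 + 1 = 5 * K by omega] at hv
    have h := hv.init ((row_iff hg hK (by omega) (by omega)).2 (Nat.mul_mod_left _ _))
      (Fin.ext ?_) (hnew p 0 hp (by omega))
    · rwa [bit_eq hg (by omega) (by omega)] at h
    · rw [rblk_val hg hK (by omega) (by omega), show 5 * K - 1 = 4 * K + (K - 1) by omega,
        (mul_add_mod_div 4 (by omega)).2]
      rfl
  · intro p t hp ht hWt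
    have h1 := hle hp
    have h4 := hmul p
    have h0 := hr p t hp ht
    -- The bottom row lies in the row block just below the final one, so its `old` flags show the
    -- final marks.
    have hn : n - 1 = (5 + t + 1) * K + (n - 1) % K := by
      conv_lhs => rw [← Nat.div_add_mod' (n - 1) K]
      rw [show (n - 1) / K = 5 + t + 1 by omega]
    have hb := (hg.bottom ((5 + p) * K + r p t) (by omega)).2
    have hold := old_eq hg hK (i := (5 + p) * K + r p t) (T := 5 + t) (s := (n - 1) % K) (by omega)
      (Nat.mod_lt _ hpos) (by omega)
    rw [← hn, hnew p t hp ht] at hold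
    have h := hb hold
    rwa [stat_eq hg (by omega) (by omega), stat_mod hg hK (by omega), (mul_add_mod_div _ h0).1,
      hbit 4 _ p hp (by decide) h0] at h

end universalSystem

/-! ### The picture of a given array of marks -/

namespace universalSystem

/-- The periodic patterns for an input `m`. -/
def pattern (m K r : ℕ) (k : Fin 5) : Bool :=
  if k = 0 then decide (r = 0) else blockBit m K k r

/-- The offset of the mark in a block, or `K` if there is none. -/
def offset (K : ℕ) (r : ℕ → ℕ → ℕ) (P T : ℕ) : ℕ :=
  if 5 ≤ P ∧ 5 ≤ T then r (P - 5) (T - 5) else K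

/-- The picture that displays an array of marks. -/
def picture (m K : ℕ) (r : ℕ → ℕ → ℕ) (i y : ℕ) : UCell where
  dig := (m - y).testBit i
  borrow := decide ((m - y) % 2 ^ i = 0)
  bit := m.testBit i
  stat := pattern m K (i % K)
  pat := pattern m K (circDiff K y i)
  patl := pattern m K (circDiff K (y + 1) i)
  row := decide (y % K = 0)
  blk := ⟨min (i / K) 5, by omega⟩
  rblk := ⟨min (y / K) 5, by omega⟩
  new := decide (i % K = offset K r (i / K) (y / K))
  old := decide (i % K = offset K r (i / K) (y / K - 1))
  seen := decide (offset K r (i / K) (y / K) ≤ i % K)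
  sendH := decide (y % K = offset K r (i / K) (y / K))
  recvH := decide (y % K = offset K r (i / K - 1) (y / K))
  recvV := decide (y % K = offset K r (i / K) (y / K - 1))

variable {m n K W : ℕ} {r : ℕ → ℕ → ℕ}

/-- The dummy offset `K` is no residue modulo `K`, so a flag that is set proves that its block
belongs to the array. -/
theorem le_of_offset_lt {P T : ℕ} (h : offset K r P T < K) :
    5 ≤ P ∧ 5 ≤ T ∧ offset K r P T = r (P - 5) (T - 5) := by
  unfold offset at h ⊢
  split_ifs at h ⊢ with h'
  · exact ⟨h'.1, h'.2, rfl⟩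
  · exact absurd h (lt_irrefl K)

theorem pattern_of_ne_zero {s : ℕ} {k : Fin 5} (hk : k ≠ 0) :
    pattern m K s k = blockBit m K k s := if_neg hk

theorem pattern_zero {s : ℕ} : pattern m K s 0 = decide (s = 0) := if_pos rfl

theorem picture_ok (hK : BlockLength m K) (hr : MarkArray m K n W r) {i y : ℕ} (hi : i < n)
    (hy : y < n) : (picture m K r i y).Ok := by
  have hiK := Nat.mod_lt i hK.pos
  have hyK := Nat.mod_lt y hK.pos
  have hid := Nat.div_le_self i K
  have hyd := Nat.div_le_self y K
  constructor <;> simp only [picture, decide_eq_true_eq]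
  · intro h
    rw [circDiff_of_mod_eq_zero hK.pos h]
  · simp only [pattern_zero, circDiff_eq_zero_iff hK.pos, decide_eq_true_eq]
    intro h
    rw [h]
  · intro k hk h
    have h1 : i / K = k := by omega
    rw [pattern_of_ne_zero hk, blockBit, ← h1, Nat.div_add_mod']
  · intro h
    obtain ⟨h1, h2, h3⟩ := le_of_offset_lt (h ▸ hiK)
    rw [pattern_of_ne_zero (by decide), h, h3]
    exact hr.valid _ _ (by omega) (by omega)
  · intro h h'
    obtain ⟨h1, h2, h3⟩ := le_of_offset_lt (h ▸ hyK)
    obtain ⟨h4, h5, h6⟩ := le_of_offset_lt (h' ▸ hiK)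
    have := hr.horizontal (i / K - 1 - 5) (y / K - 5) (by omega) (by omega)
    rw [pattern_of_ne_zero (by decide), ← circDiff_mod_mod hK.pos, h, h', h3, h6]
    rwa [show i / K - 1 - 5 + 1 = i / K - 5 by omega] at this
  · intro h h'
    obtain ⟨h1, h2, h3⟩ := le_of_offset_lt (h ▸ hyK)
    obtain ⟨h4, h5, h6⟩ := le_of_offset_lt (h' ▸ hiK)
    have := hr.vertical (i / K - 5) (y / K - 1 - 5) (by omega) (by omega)
    rw [pattern_of_ne_zero (by decide), ← circDiff_mod_mod hK.pos, h, h', h3, h6]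
    rwa [show y / K - 1 - 5 + 1 = y / K - 5 by omega] at this
  · simp only [pattern_zero, circDiff_eq_zero_iff hK.pos, decide_eq_true_eq]
    intro h h'
    rw [h', h]
  · simp only [pattern_zero, circDiff_eq_zero_iff hK.pos, decide_eq_true_eq]
    intro h h'
    rw [h', h]

theorem picture_hRel (hK : BlockLength m K) (hr : MarkArray m K n W r) {i y : ℕ} (hi : i + 1 < n)
    (hy : y < n) : UCell.HRel (picture m K r i y) (picture m K r (i + 1) y) := by
  have hpos := hK.pos
  have hdm := succ_div_mod hpos i
  have hiK := Nat.mod_lt i hpos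
  have hid := Nat.div_le_self i K
  have hyd := Nat.div_le_self y K
  refine ⟨picture_ok hK hr hi hy, ?_, rfl, ?_, ?_, ?_, ?_, ?_, ?_, ?_⟩ <;>
    simp only [picture, pattern_zero, decide_eq_true_eq, decide_eq_false_iff_not]
  · exact decide_mod_two_pow_succ _ _
  · rw [circDiff_succ_succ hpos]
  · refine Fin.ext ?_
    rcases hdm with ⟨h1, h2, -⟩ | ⟨h1, h2⟩
    · simp only [h1, h2, if_pos, UCell.next]
      omega
    · simp only [h1, h2, Nat.add_eq_zero_iff, one_ne_zero, and_false, if_false]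
  · intro h
    have h0 : i / K = 0 := by
      have : min (i / K) 5 = 0 := congrArg Fin.val h
      omega
    have hlt : i < K := by
      by_contra hge
      have := Nat.div_pos (not_lt.1 hge) hpos
      omega
    rcases Nat.lt_or_ge (i + 1) K with h1 | h1
    · rw [hK.zero _ (by omega) h1, Nat.mod_eq_of_lt h1]
      simp
    · obtain rfl : K = i + 1 := by omega
      rw [hK.one]
      simp
  · rcases hdm with ⟨h1, h2, h3⟩ | ⟨h1, h2⟩
    · rw [h1, h2]
      intro h
      left
      omega
    · rw [h1, h2]
      intro h
      omega
  · rcases hdm with ⟨h1, h2, h3⟩ | ⟨h1, h2⟩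
    · intro _ h4 h5
      have h4 : min (i / K) 5 = 5 := congrArg Fin.val h4
      have h5 : min (y / K) 5 = 5 := congrArg Fin.val h5
      have := hr.lt (i / K - 5) (y / K - 5) (by omega) (by omega)
      rw [offset, if_pos ⟨by omega, by omega⟩]
      omega
    · omega
  · rcases hdm with ⟨h1, h2, h3⟩ | ⟨h1, h2⟩
    · intro h; exact absurd h1 h
    · simp [h2]
  · rcases hdm with ⟨h1, h2, h3⟩ | ⟨h1, h2⟩
    · simp [h2]
    · omega

theorem picture_vRel (hK : BlockLength m K) (hr : MarkArray m K n W r) (hn : n = m + 1) {i y : ℕ}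
    (hi : i < n) (hy : y + 1 < n) : UCell.VRel (picture m K r i y) (picture m K r i (y + 1)) := by
  have hpos := hK.pos
  have hdm := succ_div_mod hpos y
  have hiK := Nat.mod_lt i hpos
  have hid := Nat.div_le_self i K
  refine ⟨?_, rfl, rfl, rfl, ?_, ?_, ?_, ?_⟩ <;>
    simp only [picture, decide_eq_true_eq, decide_eq_false_iff_not]
  · rw [testBit_eq_xor_succ, show m - (y + 1) + 1 = m - y by omega]
  · refine Fin.ext ?_
    rcases hdm with ⟨h1, h2, -⟩ | ⟨h1, h2⟩
    · simp only [h1, h2, if_pos, UCell.next]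
      omega
    · simp only [h1, h2, Nat.add_eq_zero_iff, one_ne_zero, and_false, if_false]
  · rcases hdm with ⟨h1, h2, h3⟩ | ⟨h1, h2⟩
    · intro h; exact absurd h1 h
    · simp [h2]
  · rcases hdm with ⟨h1, h2, h3⟩ | ⟨h1, h2⟩
    · simp [h2]
    · omega
  · rcases hdm with ⟨h1, h2, h3⟩ | ⟨h1, h2⟩
    · intro _ h4 h5
      have h4 : min (y / K) 5 = 4 := congrArg Fin.val h4
      obtain ⟨h6, h7, h8⟩ := le_of_offset_lt (h5 ▸ hiK)
      have := hr.init (i / K - 5) (by omega)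
      rw [h8, h2, show y / K + 1 - 5 = 0 by omega] at h5
      rwa [blockBit, ← h5, show 5 + (i / K - 5) = i / K by omega, Nat.div_add_mod'] at this
    · omega

/-- The marks are required for all indices up to `m` rather than `m / K - 5`, so that incomplete
blocks at the right and lower edges are covered as well. -/
theorem isPicture_picture (hK : BlockLength m K) (hr : MarkArray m K (m + 1) (m / K - 5) r) :
    universalSystem.IsPicture (m + 1) (picture m K r) := by
  refine ⟨fun i y hi hy => picture_hRel hK hr hi hy, fun i y hi hy => picture_vRel hK hr rfl hi hy,
    fun y hy => ⟨picture_ok hK hr (by omega) hy, ?_, ?_, ?_⟩, fun i hi => ⟨?_, ?_, ?_⟩,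
    fun i hi => ⟨?_, ?_⟩⟩
  · simp [picture, pattern]
  · simp [picture]
  · simp [picture, Nat.mod_one]
  · simp [picture]
  · simp [picture]
  · simp [picture]
  · simp [picture]
  · simp only [picture, decide_eq_true_eq, Nat.add_sub_cancel]
    intro h
    have hiK := Nat.mod_lt i hK.pos
    have hid := Nat.div_le_self i K
    have hmd := Nat.div_le_self m K
    obtain ⟨h6, h7, h8⟩ := le_of_offset_lt (h ▸ hiK)
    rw [pattern_of_ne_zero (by decide), h, h8]
    exact hr.final _ _ (by omega) (by omega) (by omega)

end universalSystem

/-! ### Arrays over a finite alphabet, coded by the universal picture system -/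

/-- Local constraints for arrays over a finite alphabet. -/
structure ArraySystem where
  /-- the alphabet -/
  A : Type
  [finA : Finite A]
  [nonemptyA : Nonempty A]
  /-- the relation between a symbol and its right neighbour -/
  H : A → A → Prop
  /-- the relation between a symbol and its lower neighbour -/
  V : A → A → Prop
  /-- the symbols allowed in the final row -/
  F : A → Prop

namespace ArraySystem

/-- The first `X` rows and columns of `a` satisfy the constraints, the first row satisfies the
initial conditions `I` and row `W - 1` is final. -/
structure IsArray (S : ArraySystem) (X W : ℕ) (I : List (S.A → Prop)) (a : ℕ → ℕ → S.A) :
    Prop where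
  horizontal : ∀ p t, p + 1 < X → t < X → S.H (a p t) (a (p + 1) t)
  vertical : ∀ p t, p < X → t + 1 < X → S.V (a p t) (a p (t + 1))
  init : ∀ p, p < X → ∀ i ∈ I[p]?, i (a p 0)
  final : ∀ p t, p < X → t < X → t + 1 = W → S.F (a p t)

/-- A coding of the alphabet, doubled by a parity bit, by offsets in blocks of length `K`, such that
the constraints can be read off tables indexed by differences of offsets. -/
structure Coding (S : ArraySystem) where
  /-- the block length -/
  K : ℕ
  /-- the offset of a symbol -/
  mark : S.A × Bool → ℕ
  /-- the tables -/
  tab : Fin 5 → ℕ → Bool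
  two_le : 2 ≤ K
  mark_lt : ∀ x, mark x < K - 1
  mark_injective : Function.Injective mark
  exists_mark_zero : ∃ x, mark x = 0
  valid : ∀ r, tab 1 r = true ↔ ∃ x, mark x = r
  horizontal : ∀ x y, tab 2 (circDiff K (mark x) (mark y)) = true ↔ S.H x.1 y.1 ∧ x.2 ≠ y.2
  vertical : ∀ x y, tab 3 (circDiff K (mark x) (mark y)) = true ↔ S.V x.1 y.1 ∧ x.2 ≠ y.2
  final : ∀ x, tab 4 (mark x) = true ↔ S.F x.1
  tab_zero : ∀ r, tab 0 r = false

open Classical in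
-- Enumerate the doubled alphabet and use the ruler `2 ^ j - 1` modulo `2 ^ (k + 1)`. Pairs of
-- different parity are distinct, hence recoverable from their difference, and the tables may list
-- exactly the differences of admissible pairs.
theorem exists_coding (S : ArraySystem) : Nonempty S.Coding := by
  have := S.finA
  have := S.nonemptyA
  obtain ⟨k, ⟨e⟩⟩ := Finite.exists_equiv_fin (S.A × Bool)
  have hk : 0 < k := Fin.pos (e (Classical.arbitrary _))
  let K := 2 ^ (k + 1)
  let mark : S.A × Bool → ℕ := fun x => 2 ^ (e x).val - 1
  have hpow : ∀ x, 1 ≤ 2 ^ (e x).val ∧ 2 ^ (e x).val < 2 ^ k := fun x =>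
    ⟨Nat.one_le_two_pow, Nat.pow_lt_pow_right (by norm_num) (e x).2⟩
  have hinj : Function.Injective mark := by
    intro x y h
    have h1 := (hpow x).1
    have h2 := (hpow y).1
    have h3 : 2 ^ (e x).val = 2 ^ (e y).val := by
      simp only [mark] at h
      omega
    exact e.injective (Fin.ext (Nat.pow_right_injective le_rfl h3))
  have hKpow : K = 2 * 2 ^ k := by rw [← pow_succ']
  have hdiff : ∀ x y x' y', x' ≠ y' →
      circDiff K (mark x) (mark y) = circDiff K (mark x') (mark y') → x = x' ∧ y = y' := by
    intro x y x' y' hxy' h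
    have hne : ∀ {x y : S.A × Bool}, x ≠ y → (e x).val ≠ (e y).val := fun h h' =>
      h (e.injective (Fin.ext h'))
    -- Equal symbols give difference 0, which no two distinct marks below `K` share; otherwise the
    -- ruler property applies.
    by_cases hxy : x = y
    · subst hxy
      rw [(circDiff_eq_zero_iff (Nat.two_pow_pos _)).2 rfl, eq_comm,
        circDiff_eq_zero_iff (Nat.two_pow_pos _)] at h
      have h1 := hpow x'
      have h2 := hpow y'
      rw [Nat.mod_eq_of_lt, Nat.mod_eq_of_lt] at h
      · exact absurd (hinj h) hxy'
      all_goals simp only [mark]; omega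
    · have h' := circDiff_two_pow_inj (e x).2 (e y).2 (e x').2 (e y').2 (hne hxy) (hne hxy') h
      exact ⟨e.injective (Fin.ext h'.1), e.injective (Fin.ext h'.2)⟩
  let table (R : S.A → S.A → Prop) (r : ℕ) : Prop :=
    ∃ x y, (R x.1 y.1 ∧ x.2 ≠ y.2) ∧ r = circDiff K (mark x) (mark y)
  have htable : ∀ (R : S.A → S.A → Prop) x y,
      table R (circDiff K (mark x) (mark y)) ↔ R x.1 y.1 ∧ x.2 ≠ y.2 := by
    intro R x y
    constructor
    · rintro ⟨x', y', h, h'⟩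
      obtain ⟨rfl, rfl⟩ := hdiff x y x' y' (fun h' => h.2 (congrArg Prod.snd h')) h'
      exact h
    · intro h
      exact ⟨x, y, h, rfl⟩
  exact ⟨{
    K := K
    mark := mark
    tab := ![fun _ => false, fun r => decide (∃ x, mark x = r), fun r => decide (table S.H r),
      fun r => decide (table S.V r), fun r => decide (∃ x, S.F x.1 ∧ mark x = r)]
    two_le := by have := Nat.two_pow_pos k; omega
    mark_lt := fun x => by have := hpow x; simp only [mark]; omega
    mark_injective := hinj
    exists_mark_zero := ⟨e.symm ⟨0, hk⟩, by simp [mark]⟩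
    valid := fun r => by simp
    horizontal := fun x y => by simpa using htable S.H x y
    vertical := fun x y => by simpa using htable S.V x y
    final := fun x => by
      simp only [Matrix.cons_val, decide_eq_true_eq]
      exact ⟨fun ⟨y, h, h'⟩ => hinj h' ▸ h, fun h => ⟨x, h, rfl⟩⟩
    tab_zero := fun r => rfl }⟩

/-- The concatenation of blocks of length `K`. -/
def blockWord (K : ℕ) (L : List (ℕ → Bool)) : List Bool :=
  L.flatMap fun φ => (List.range K).map φ

theorem blockWord_getElem? {K r : ℕ} (hr : r < K) (L : List (ℕ → Bool)) (k : ℕ) :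
    (blockWord K L)[k * K + r]? = L[k]?.map fun φ => φ r := by
  induction L generalizing k with
  | nil => simp [blockWord]
  | cons φ L ih =>
    rw [blockWord, List.flatMap_cons, ← blockWord]
    cases k with
    | zero => simp [List.getElem?_append, hr]
    | succ k =>
      rw [List.getElem?_append_right (by simp; nlinarith)]
      simp only [List.length_map, List.length_range, List.getElem?_cons_succ]
      rw [show (k + 1) * K + r - K = k * K + r by rw [add_mul]; omega, ih]

theorem length_blockWord (K : ℕ) (L : List (ℕ → Bool)) :
    (blockWord K L).length = L.length * K := by
  induction L with
  | nil => simp [blockWord]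
  | cons φ L ih =>
    rw [blockWord, List.flatMap_cons, ← blockWord]
    simp [ih]
    ring

theorem blockBit_bitsVal {K r : ℕ} (hr : r < K) (L : List (ℕ → Bool)) (k : ℕ) :
    blockBit (bitsVal (blockWord K L)) K k r = (L[k]?.map fun φ => φ r).getD false := by
  rw [blockBit, testBit_bitsVal, blockWord_getElem? hr]

/-! ### The number that codes an array problem -/

namespace Coding

variable {S : ArraySystem} (c : S.Coding)

open Classical in
/-- The block that expresses an initial condition. -/
noncomputable def initBlock (i : S.A → Prop) (r : ℕ) : Bool :=
  decide (∃ x, c.mark x = r ∧ ¬i x.1)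

/-- The blocks of the input: the tables, initial conditions, padding, and the final digit. -/
noncomputable def blocks (I : List (S.A → Prop)) (q : ℕ) : List (ℕ → Bool) :=
  [c.tab 0, c.tab 1, c.tab 2, c.tab 3, c.tab 4] ++ I.map c.initBlock ++
    List.replicate q (fun _ => false) ++ [fun r => decide (r = c.K - 1)]

/-- The number that codes initial conditions, with `q` blocks of padding. -/
noncomputable def code (I : List (S.A → Prop)) (q : ℕ) : ℕ :=
  bitsVal (blockWord c.K (c.blocks I q))

theorem blockBit_tab {I : List (S.A → Prop)} {q r : ℕ} (k : Fin 5) (hr : r < c.K) :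
    blockBit (c.code I q) c.K k r = c.tab k r := by
  rw [code, blockBit_bitsVal hr, blocks]
  fin_cases k <;> rfl

/-- A digit 1 forbids an offset. Blocks beyond the list forbid nothing: the padding is 0, and the
leading digit stands at offset `K - 1`, which is never a mark. -/
theorem blockBit_init {I : List (S.A → Prop)} {q p : ℕ} (x : S.A × Bool) :
    blockBit (c.code I q) c.K (5 + p) (c.mark x) = false ↔ ∀ i ∈ I[p]?, i x.1 := by
  have hx := c.mark_lt x
  rw [code, blockBit_bitsVal (by omega), blocks, add_comm 5 p]
  simp only [List.cons_append, List.nil_append, List.getElem?_cons_succ, List.append_assoc]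
  rcases Nat.lt_or_ge p I.length with h | h
  · rw [List.getElem?_append_left (by simpa using h), List.getElem?_map]
    simp only [List.getElem?_eq_getElem h, Option.map_some, Option.getD_some, Option.mem_def,
      Option.some.injEq, forall_eq', initBlock, decide_eq_false_iff_not, not_exists, not_and,
      not_not]
    exact ⟨fun h => h x rfl, fun h y hy => c.mark_injective hy ▸ h⟩
  · rw [List.getElem?_append_right (by simpa using h)]
    simp only [List.getElem?_eq_none h, Option.not_mem_none, false_imp_iff, implies_true, iff_true]
    rw [Bool.eq_false_iff]
    intro h'
    rw [Option.getD_eq_iff] at h'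
    simp only [Option.map_eq_some_iff, Bool.false_eq_true, and_false, or_false] at h'
    obtain ⟨φ, hφ, hφ'⟩ := h'
    have hmem := List.mem_of_getElem? hφ
    simp only [List.mem_append, List.mem_replicate, List.mem_singleton] at hmem
    rcases hmem with ⟨-, rfl⟩ | rfl
    · simp at hφ'
    · simp at hφ'
      omega

/-- Table 0 is empty, and table 1 starts with 1 because some symbol has mark 0. -/
theorem blockLength (I : List (S.A → Prop)) (q : ℕ) : universalSystem.BlockLength (c.code I q) c.K := by
  have hK := c.two_le
  refine ⟨by omega, fun i hi hiK => ?_, ?_⟩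
  · have := c.blockBit_tab (I := I) (q := q) 0 hiK
    simpa [blockBit, c.tab_zero] using this
  · have := c.blockBit_tab (I := I) (q := q) 1 (r := 0) (by omega)
    rw [(c.valid 0).2 c.exists_mark_zero] at this
    simpa [blockBit] using this

theorem exists_isArray {I : List (S.A → Prop)} {q : ℕ} {g : ℕ → ℕ → UCell}
    (hg : universalSystem.IsPicture (c.code I q + 1) g) :
    ∃ a, S.IsArray (c.code I q / c.K - 5) (c.code I q / c.K - 5) I a := by
  have hpos : 0 < c.K := (c.blockLength I q).pos
  obtain ⟨r, hr⟩ := universalSystem.exists_markArray hg (c.blockLength I q)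
  rw [Nat.add_sub_cancel] at hr
  set W := c.code I q / c.K - 5
  have hex : ∀ p t, p < W → t < W → ∃ x, c.mark x = r p t := by
    intro p t hp ht
    have h := hr.valid p t hp ht
    rw [← c.valid, ← h]
    exact (c.blockBit_tab 1 (hr.lt p t hp ht)).symm
  have := S.nonemptyA
  choose! x hx using hex
  refine ⟨fun p t => (x p t).1, fun p t hp ht => ?_, fun p t hp ht => ?_, fun p hp => ?_,
    fun p t hp ht hW => ?_⟩
  · have h := hr.horizontal p t hp ht
    rw [← hx p t (by omega) ht, ← hx (p + 1) t hp ht] at h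
    exact ((c.horizontal _ _).1 ((c.blockBit_tab 2 (circDiff_lt hpos _ _)).symm.trans h)).1
  · have h := hr.vertical p t hp ht
    rw [← hx p t hp (by omega), ← hx p (t + 1) hp ht] at h
    exact ((c.vertical _ _).1 ((c.blockBit_tab 3 (circDiff_lt hpos _ _)).symm.trans h)).1
  · have h := hr.init p hp
    rw [← hx p 0 hp (by omega)] at h
    exact (c.blockBit_init _).1 h
  · have h := hr.final p t hp ht hW
    have hlt := hr.lt p t hp ht
    rw [← hx p t hp ht] at h hlt
    exact (c.final _).1 ((c.blockBit_tab 4 hlt).symm.trans h)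

theorem exists_isPicture {I : List (S.A → Prop)} {q : ℕ} {a : ℕ → ℕ → S.A}
    (ha : S.IsArray (c.code I q + 1) (c.code I q / c.K - 5) I a) :
    ∃ g, universalSystem.IsPicture (c.code I q + 1) g := by
  have hpos : 0 < c.K := (c.blockLength I q).pos
  -- The chessboard parity makes neighbouring symbols distinct.
  let x : ℕ → ℕ → S.A × Bool := fun p t => (a p t, decide ((p + t) % 2 = 0))
  have hlt : ∀ p t, c.mark (x p t) < c.K := fun p t => by have := c.mark_lt (x p t); omega
  refine ⟨_, universalSystem.isPicture_picture (r := fun p t => c.mark (x p t))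
    (c.blockLength I q) ⟨fun p t _ _ => hlt p t, fun p t _ _ => ?_, fun p t hp ht => ?_,
      fun p t hp ht => ?_, fun p hp => ?_, fun p t hp ht hW => ?_⟩⟩
  · exact (c.blockBit_tab 1 (hlt p t)).trans ((c.valid _).2 ⟨_, rfl⟩)
  · refine (c.blockBit_tab 2 (circDiff_lt hpos _ _)).trans ((c.horizontal _ _).2
      ⟨ha.horizontal p t hp ht, ?_⟩)
    simp only [x, ne_eq, decide_eq_decide]
    omega
  · refine (c.blockBit_tab 3 (circDiff_lt hpos _ _)).trans ((c.vertical _ _).2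
      ⟨ha.vertical p t hp ht, ?_⟩)
    simp only [x, ne_eq, decide_eq_decide]
    omega
  · exact (c.blockBit_init _).2 (ha.init p hp)
  · exact (c.blockBit_tab 4 (hlt p t)).trans ((c.final _).2 (ha.final p t hp ht hW))

/-- The digits of the size of the grid for the given initial conditions. -/
noncomputable def word (I : List (S.A → Prop)) (q : ℕ) : List Bool :=
  true :: true :: (blockWord c.K (c.blocks I q)).drop 2

theorem blocks_eq_cons (I : List (S.A → Prop)) (q : ℕ) :
    ∃ L, c.blocks I q = (fun _ => false) :: L := by
  have h : c.tab 0 = fun _ => false := funext c.tab_zero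
  exact ⟨_, by rw [blocks, h]; rfl⟩

/-- The picture has `code + 1` rows and the border adds 2. Since block 0 is zero and `K ≥ 2`, adding
3 only sets the two lowest digits, without a carry. -/
theorem bitsVal_word (I : List (S.A → Prop)) (q : ℕ) :
    bitsVal (c.word I q) = c.code I q + 3 := by
  obtain ⟨L, hL⟩ := c.blocks_eq_cons I q
  obtain ⟨k, hk⟩ : ∃ k, c.K = k + 2 := ⟨c.K - 2, by have := c.two_le; omega⟩
  rw [word, code, hL, blockWord, List.flatMap_cons, hk]
  simp [bitsVal, List.replicate_succ]
  ring

theorem exists_blockWord_eq_append (I : List (S.A → Prop)) (q : ℕ) :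
    ∃ l, (5 + q) * c.K ≤ l.length ∧ blockWord c.K (c.blocks I q) = l ++ [true] := by
  obtain ⟨k, hk⟩ : ∃ k, c.K = k + 1 := ⟨c.K - 1, by have := c.two_le; omega⟩
  refine ⟨blockWord c.K ([c.tab 0, c.tab 1, c.tab 2, c.tab 3, c.tab 4] ++ I.map c.initBlock ++
    List.replicate q (fun _ => false)) ++ (List.range k).map (fun r => decide (r = c.K - 1)),
    ?_, ?_⟩
  · rw [List.length_append, length_blockWord]
    refine le_add_right (Nat.mul_le_mul_right _ ?_)
    simp
    omega
  · rw [blocks, blockWord, List.flatMap_append, ← blockWord, List.append_assoc]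
    simp [hk, List.range_succ]

theorem word_eq_append (I : List (S.A → Prop)) (q : ℕ) : ∃ l, c.word I q = l ++ [true] := by
  obtain ⟨l, hl, h⟩ := c.exists_blockWord_eq_append I q
  have hK := c.two_le
  refine ⟨true :: true :: l.drop 2, ?_⟩
  rw [word, h, List.drop_append_of_le_length (by nlinarith)]
  rfl

theorem two_pow_le_code (I : List (S.A → Prop)) (q : ℕ) :
    2 ^ ((5 + q) * c.K) ≤ c.code I q := by
  obtain ⟨l, hl, h⟩ := c.exists_blockWord_eq_append I q
  rw [code, h]
  exact (Nat.pow_le_pow_right (by norm_num) hl).trans (two_pow_le_bitsVal l)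

end Coding

/-- Grids of the size coded by `c.word I q` have a tiling if a suitable infinite array exists. -/
theorem Coding.word_mem_of_isArray {S : ArraySystem} (c : S.Coding) {I : List (S.A → Prop)} {q : ℕ}
    {a : ℕ → ℕ → S.A} (ha : S.IsArray (c.code I q + 1) (c.code I q / c.K - 5) I a) :
    c.word I q ∈ universalSystem.toTilingSystem.TILING := by
  obtain ⟨g, hg⟩ := c.exists_isPicture ha
  have h := (pos_and_eq_encodeNat_iff (c.word I q) (c.code I q + 1 + 2)).2
    ⟨c.word_eq_append I q, (c.bitsVal_word I q).symm⟩
  exact ⟨_, h.1, h.2, universalSystem.exists_isValidTiling_of_isPicture (by omega) hg⟩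

theorem Coding.exists_isArray_of_word_mem {S : ArraySystem} (c : S.Coding)
    {I : List (S.A → Prop)} {q : ℕ} (h : c.word I q ∈ universalSystem.toTilingSystem.TILING) :
    ∃ a, S.IsArray (c.code I q / c.K - 5) (c.code I q / c.K - 5) I a := by
  obtain ⟨N, hN, hw, f, hf⟩ := h
  obtain rfl : N = c.code I q + 1 + 2 :=
    ((pos_and_eq_encodeNat_iff _ _).1 ⟨hN, hw⟩).2.trans (c.bitsVal_word I q)
  obtain ⟨g, hg⟩ := universalSystem.exists_isPicture_of_isValidTiling (n := c.code I q + 1)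
    (by omega) hf
  exact c.exists_isArray hg

end ArraySystem

/-! ### Computations of nondeterministic Turing machines as arrays -/

namespace NTM

variable (M : NTM)

/-- The action displayed in a row: the new state, the written symbol and the head movement, `none`
meaning that the head stays on the leftmost cell. -/
abbrev Action := M.Q × M.Γ × Option Turing.Dir

/-- The symbols of the computation array: every symbol displays the state and the action of its row
(nothing in the initial row), together with the content of a tape cell and its position relative to
the head, or a wall. -/
abbrev Sym := Option (M.Q × Option M.Action) × Option (M.Γ × Ordering)

/-- The positions that may follow on the right. -/
def Follows : Option Ordering → Ordering → Prop
  | none, o | some .lt, o => o ≠ .gt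
  | some .eq, o | some .gt, o => o = .gt

/-- The positions that may follow below, for a given head movement. -/
def Moves : Option Turing.Dir → Ordering → Ordering → Prop
  | none, o, o' => o' = o
  | some .right, .lt, o' | some .right, .eq, o' => o' = .lt
  | some .right, .gt, o' => o' ≠ .lt
  | some .left, .gt, o' | some .left, .eq, o' => o' = .gt
  | some .left, .lt, o' => o' ≠ .gt

/-- The state displayed in a row. -/
def stateOf : Option (M.Q × Option M.Action) → M.Q
  | none => M.start
  | some (q, _) => q

/-- The action displayed in a row. -/
def actionOf : Option (M.Q × Option M.Action) → Option M.Action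
  | none => none
  | some (_, e) => e

/-- The horizontal constraints of the computation array. -/
structure SymH (l c : M.Sym) : Prop where
  info : l.1 = c.1
  cell : ∃ s o, c.2 = some (s, o) ∧ Follows (l.2.map Prod.snd) o ∧
    (l.1 = none → ∀ o', l.2 = some (M.blank, o') → s = M.blank) ∧
    ∀ e, M.actionOf c.1 = some e → o = .eq →
      (e.2.2 = none → l.2 = none) ∧ (e.2.2 = some .left → l.2 ≠ none)

/-- The vertical constraints of the computation array. -/
structure SymV (u c : M.Sym) : Prop where
  info : c.1 ≠ none
  state : M.stateOf c.1 = ((M.actionOf u.1).map Prod.fst).getD (M.stateOf u.1)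
  wall : u.2 = none → c.2 = none
  idle : M.actionOf u.1 = none → c.2 = u.2
  move : ∀ e s o, M.actionOf u.1 = some e → u.2 = some (s, o) → ∃ s' o', c.2 = some (s', o') ∧
    Moves e.2.2 o o' ∧ (o ≠ .eq → s' = s) ∧
      (o = .eq → s' = e.2.1 ∧ (e.1, e.2.1, e.2.2.getD .left) ∈ M.δ (M.stateOf u.1) s)

/-- The computation arrays of a machine. -/
def arraySystem : ArraySystem where
  A := M.Sym
  finA := by
    have := M.finQ
    have := M.finΓ
    have : Finite Turing.Dir :=
      Finite.of_injective (fun d : Turing.Dir => decide (d = .left)) (by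
        intro d d'; cases d <;> cases d' <;> simp)
    have : Finite Ordering :=
      Finite.of_injective (fun o : Ordering => (decide (o = .lt), decide (o = .eq))) (by
        intro d d'; cases d <;> cases d' <;> simp)
    infer_instance
  nonemptyA := ⟨(none, none)⟩
  H := M.SymH
  V := M.SymV
  F c := c.1 ≠ none ∧ M.stateOf c.1 = M.accept

/-- The condition on an initial tape cell with content `s`. -/
def InitCell (s : M.Γ) (c : M.Sym) : Prop :=
  ∃ o, o ≠ .lt ∧ c = (none, some (s, o))

/-- The initial conditions for the input `x`. -/
def initConditions (x : List Bool) : List (M.Sym → Prop) :=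
  [fun c => c = (none, none)] ++ x.map (fun b => M.InitCell (M.bit b)) ++ [M.InitCell M.blank]

theorem initConditions_getElem? (x : List Bool) {p : ℕ} (hp : p ≤ x.length) :
    (M.initConditions x)[p + 1]? = some (M.InitCell ((M.init x).tape p)) := by
  simp only [initConditions, List.cons_append, List.nil_append, List.getElem?_cons_succ, init]
  rcases Nat.lt_or_ge p x.length with h | h
  · rw [List.getElem?_append_left (by simpa using h)]
    simp [h]
  · obtain rfl : p = x.length := by omega
    rw [List.getElem?_append_right (by simp)]
    simp

theorem init_tape_of_le (x : List Bool) {p : ℕ} (hp : x.length ≤ p) :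
    (M.init x).tape p = M.blank := by
  simp [init, hp]

/-- Row `t` of the array `a` displays the configuration `c`. -/
structure Displays (W : ℕ) (a : ℕ → ℕ → M.Sym) (t : ℕ) (c : M.Cfg) : Prop where
  state : M.stateOf (a 0 t).1 = c.state
  wall : (a 0 t).2 = none
  cell : ∀ p, p + 1 < W → (a (p + 1) t).2 = some (c.tape p, compare p c.head)

/-! ### From arrays to computations -/

variable {M} {W : ℕ} {a : ℕ → ℕ → M.Sym} {x : List Bool}

theorem info_eq (ha : M.arraySystem.IsArray W W (M.initConditions x) a) {p t : ℕ} (hp : p < W)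
    (ht : t < W) : (a p t).1 = (a 0 t).1 := by
  induction p with
  | zero => rfl
  | succ p ih => rw [← ih (by omega)]; exact (ha.horizontal p t hp ht).info.symm

theorem corner_eq (ha : M.arraySystem.IsArray W W (M.initConditions x) a) (hW : 0 < W) :
    a 0 0 = (none, none) :=
  ha.init 0 hW _ rfl

/-- In a row with a symbol at the head position, all positions are correct. -/
theorem exists_cell_eq (ha : M.arraySystem.IsArray W W (M.initConditions x) a) {t h : ℕ}
    (ht : t < W) {s : M.Γ} (hs : (a (h + 1) t).2 = some (s, .eq))
    (hlt : ∀ p < h, ∃ s, (a (p + 1) t).2 = some (s, .lt)) (p : ℕ) (hp : p + 1 < W) :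
    ∃ s, (a (p + 1) t).2 = some (s, compare p h) := by
  rcases lt_trichotomy p h with hph | rfl | hph
  · rw [Nat.compare_eq_lt.2 hph]; exact hlt p hph
  · rw [Nat.compare_eq_eq.2 rfl]; exact ⟨s, hs⟩
  · rw [Nat.compare_eq_gt.2 hph]
    induction p, hph using Nat.le_induction with
    | base =>
      obtain ⟨s', o, h1, h2, -⟩ := (ha.horizontal (h + 1) t hp ht).cell
      rw [hs] at h2
      exact ⟨s', h1.trans (by rw [show o = .gt from h2])⟩
    | succ p hph ih =>
      obtain ⟨s₀, h0⟩ := ih (by omega)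
      obtain ⟨s', o, h1, h2, -⟩ := (ha.horizontal (p + 1) t hp ht).cell
      rw [h0] at h2
      exact ⟨s', h1.trans (by rw [show o = .gt from h2])⟩

/-- In the first cell the initial condition excludes `.lt` and the wall excludes `.gt`, which places
the head. Explicit conditions end with one blank; from there the horizontal constraint spreads
blanks to the right. -/
theorem displays_init (ha : M.arraySystem.IsArray W W (M.initConditions x) a) (hW : 0 < W) :
    M.Displays W a 0 (M.init x) := by
  have hc := corner_eq ha hW
  refine ⟨by rw [hc]; rfl, by rw [hc], fun p hp => ?_⟩
  have hsym : ∃ o, (a (p + 1) 0).2 = some ((M.init x).tape p, o) ∧ (p = 0 → o ≠ .lt) := by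
    rcases Nat.lt_or_ge x.length p with hxp | hxp
    · rw [M.init_tape_of_le x hxp.le]
      induction p, hxp using Nat.le_induction with
      | base =>
        obtain ⟨o', -, h'⟩ := ha.init (x.length + 1) (by omega) _
          (M.initConditions_getElem? x le_rfl)
        obtain ⟨s, o, h1, -, h3, -⟩ := (ha.horizontal (x.length + 1) 0 hp hW).cell
        rw [M.init_tape_of_le x le_rfl] at h'
        rw [h3 (by rw [h']) o' (by rw [h'])] at h1
        exact ⟨o, h1, by simp⟩
      | succ p hxp ih =>
        obtain ⟨o', h', -⟩ := ih (by omega)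
        obtain ⟨s, o, h1, -, h3, -⟩ := (ha.horizontal (p + 1) 0 hp hW).cell
        rw [h3 (by rw [info_eq ha (by omega) hW, hc]) o' h'] at h1
        exact ⟨o, h1, by simp⟩
    · obtain ⟨o, ho, h⟩ := ha.init (p + 1) hp _ (M.initConditions_getElem? x hxp)
      exact ⟨o, by rw [h], fun _ => ho⟩
  have h0 : ∃ s, (a 1 0).2 = some (s, .eq) := by
    obtain ⟨o, ho, h⟩ := ha.init 1 (by omega) _ (M.initConditions_getElem? x (Nat.zero_le _))
    obtain ⟨s, o', h1, h2, -⟩ := (ha.horizontal 0 0 (by omega) hW).cell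
    rw [hc] at h2
    rw [h] at h1
    obtain ⟨-, rfl⟩ : _ ∧ o = o' := by simpa using h1
    have : o = .eq := by cases o <;> simp_all [Follows]
    exact ⟨_, by rw [h, this]⟩
  obtain ⟨s, hs⟩ := h0
  obtain ⟨s', hs'⟩ := exists_cell_eq ha hW hs (by simp) p hp
  obtain ⟨o, ho, -⟩ := hsym
  rw [hs'] at ho
  obtain ⟨rfl, -⟩ : s' = _ ∧ _ := by simpa using ho
  exact hs'

/-- The vertical constraint leaves the new head position open on the side it moves to; the order of
positions enforced by `Follows` resolves this. As the action is shared by the whole row, all cells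
agree on the transition. -/
theorem exists_displays_succ (ha : M.arraySystem.IsArray W W (M.initConditions x) a) {t : ℕ}
    {c : M.Cfg} (ht : t + 1 < W) (hd : M.Displays W a t c) (hh : c.head + 1 < W) :
    ∃ c', (c' = c ∨ M.actionOf (a 0 t).1 ≠ none ∧ M.Step c c') ∧ M.Displays W a (t + 1) c' := by
  have hv := fun p hp => ha.vertical p t hp ht
  have hw := (hv 0 (by omega)).wall hd.wall
  have hst := (hv 0 (by omega)).state
  have hinfo : ∀ p < W, (a p t).1 = (a 0 t).1 := fun p hp => info_eq ha hp (by omega)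
  rcases he : M.actionOf (a 0 t).1 with _ | ⟨q, b, mv⟩
  · rw [he] at hst
    refine ⟨c, Or.inl rfl, hst.trans hd.state, hw, fun p hp => ?_⟩
    rw [(hv (p + 1) hp).idle (by rw [hinfo _ hp, he])]
    exact hd.cell p hp
  · rw [he] at hst
    have hmove := fun p hp => (hv (p + 1) hp).move _ _ _ ((congrArg _ (hinfo _ hp)).trans he)
      (hd.cell p hp)
    obtain ⟨s', o', h1, h2, -, h4⟩ := hmove c.head hh
    obtain ⟨-, hδ⟩ := h4 (Nat.compare_eq_eq.2 rfl)
    rw [hinfo _ hh, hd.state] at hδ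
    simp only at hδ
    refine ⟨⟨q, moveHead (mv.getD .left) c.head, Function.update c.tape c.head b⟩,
      Or.inr ⟨by simp, q, b, mv.getD .left, hδ, rfl⟩, hst, hw, fun p hp => ?_⟩
    have hsym : ∀ p, p + 1 < W → ∃ o, (a (p + 1) (t + 1)).2 =
        some (Function.update c.tape c.head b p, o) ∧ Moves mv (compare p c.head) o := by
      intro p hp
      obtain ⟨s', o', h1, h2, h3, h4⟩ := hmove p hp
      refine ⟨o', ?_, h2⟩
      rw [h1]
      by_cases hpc : p = c.head
      · subst hpc
        rw [(h4 (Nat.compare_eq_eq.2 rfl)).1, Function.update_self]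
      · rw [h3 (fun h => hpc (Nat.compare_eq_eq.1 h)), Function.update_of_ne hpc]
    have hpos : ∀ p, p + 1 < W → ∃ s, (a (p + 1) (t + 1)).2 =
        some (s, compare p (moveHead (mv.getD .left) c.head)) := by
      obtain ⟨s₀, o₀, hs₀, -, -, hm₀⟩ := (ha.horizontal c.head t hh (by omega)).cell
      obtain ⟨rfl, rfl⟩ : _ = s₀ ∧ _ = o₀ := by simpa using (hd.cell _ hh).symm.trans hs₀
      have hm₀ := hm₀ (q, b, mv) (by rw [hinfo _ hh, he]) rfl
      have heq : c.head ≠ 0 → (a c.head t).2 ≠ none := by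
        intro h
        obtain ⟨k, hk⟩ := Nat.exists_eq_succ_of_ne_zero h
        rw [hk, hd.cell k (by omega)]
        simp
      rcases mv with _ | _ | _
      -- A head that stays must have the wall on its left: this is a left move from the leftmost
      -- cell.
      · have h0 : c.head = 0 := by
          by_contra h
          exact heq h (hm₀.1 rfl)
        intro p hp
        obtain ⟨o, h1, h2⟩ := hsym p hp
        refine ⟨Function.update c.tape c.head b p, h1.trans ?_⟩
        rw [show o = _ from h2]
        simp [h0, moveHead]
      · obtain ⟨k, hk⟩ : ∃ k, c.head = k + 1 := by
          refine Nat.exists_eq_succ_of_ne_zero fun h0 => hm₀.2 rfl ?_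
          rw [h0, hd.wall]
        have hgt : ∃ s, (a (k + 1 + 1) (t + 1)).2 = some (s, .gt) := by
          obtain ⟨o, h1, h2⟩ := hsym (k + 1) (by omega)
          rw [← hk, Nat.compare_eq_eq.2 rfl] at h2
          exact ⟨_, h1.trans (by rw [show o = .gt from h2])⟩
        have hle : ∀ p ≤ k, ∃ s o, (a (p + 1) (t + 1)).2 = some (s, o) ∧ o ≠ .gt := by
          intro p hp
          obtain ⟨o, h1, h2⟩ := hsym p (by omega)
          rw [Nat.compare_eq_lt.2 (by omega)] at h2
          exact ⟨_, o, h1, h2⟩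
        obtain ⟨s, o, h1, h2⟩ := hle k le_rfl
        obtain ⟨s', o', h3, h4, -⟩ := (ha.horizontal (k + 1) (t + 1) (by omega) ht).cell
        obtain ⟨s'', h5⟩ := hgt
        rw [h5] at h3
        obtain ⟨-, rfl⟩ : _ ∧ Ordering.gt = o' := by simpa using h3
        rw [h1] at h4
        -- The old head cell is now to the right of the head, and the cell before it is not, so that
        -- cell holds the head.
        have ho : o = .eq := by cases o <;> simp_all [Follows]
        subst ho
        intro p hp
        have hhead : moveHead ((some Turing.Dir.left).getD .left) c.head = k := by
          simp [moveHead, hk]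
        rw [hhead]
        refine exists_cell_eq ha ht h1 (fun p hp => ?_) p hp
        obtain ⟨s, o, h1, h2⟩ := hle p hp.le
        obtain ⟨s₂, o₂, h3, h4⟩ := hle (p + 1) hp
        obtain ⟨s', o', h5, h6, -⟩ := (ha.horizontal (p + 1) (t + 1) (by omega) ht).cell
        obtain ⟨-, rfl⟩ : _ ∧ o₂ = o' := by simpa using h3.symm.trans h5
        rw [h1] at h6
        have ho : o = .lt := by cases o <;> simp_all [Follows]
        exact ⟨s, ho ▸ h1⟩
      · have hle : ∀ p ≤ c.head, ∃ s, (a (p + 1) (t + 1)).2 = some (s, .lt) := by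
          intro p hp
          obtain ⟨o, h1, h2⟩ := hsym p (by omega)
          have ho : o = .lt := by
            rcases hp.lt_or_eq with h | h
            · rwa [Nat.compare_eq_lt.2 h] at h2
            · rwa [Nat.compare_eq_eq.2 h] at h2
          exact ⟨_, h1.trans (by rw [ho])⟩
        have hhead : moveHead ((some Turing.Dir.right).getD .left) c.head = c.head + 1 := rfl
        rw [hhead]
        intro p hp
        rcases Nat.lt_or_ge p (c.head + 1) with hlt | hge
        · rw [Nat.compare_eq_lt.2 hlt]
          exact hle p (by omega)
        · obtain ⟨s, h1⟩ := hle c.head le_rfl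
          obtain ⟨s', o', h3, h4, -⟩ := (ha.horizontal (c.head + 1) (t + 1) (by omega) ht).cell
          obtain ⟨o, h5, h6⟩ := hsym (c.head + 1) (by omega)
          obtain ⟨-, rfl⟩ : _ ∧ o = o' := by simpa using h5.symm.trans h3
          rw [h1] at h4
          rw [Nat.compare_eq_gt.2 (by omega)] at h6
          have h4 : o ≠ .gt := h4
          have h6 : o ≠ .lt := h6
          have ho : o = .eq := by
            cases o
            exacts [absurd rfl h6, rfl, absurd rfl h4]
          exact exists_cell_eq ha ht (ho ▸ h5) (fun p hp => hle p (by omega)) p hp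
    obtain ⟨s, hs⟩ := hpos p hp
    obtain ⟨o, ho, -⟩ := hsym p hp
    rw [hs] at ho
    obtain ⟨rfl, -⟩ : s = _ ∧ _ := by simpa using ho
    exact hs

/-- Row 0 performs no action, so in row `t` the head is at most at `t - 1` and never leaves the `W`
displayed columns. A square array therefore suffices, whatever happens at its right edge. -/
theorem acceptsWithin_of_isArray (ha : M.arraySystem.IsArray W W (M.initConditions x) a)
    (hW : 0 < W) : ∃ t, M.AcceptsWithin x t := by
  have key : ∀ t < W, ∃ c s, M.ReachesIn s (M.init x) c ∧ c.head ≤ t - 1 ∧ M.Displays W a t c := by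
    intro t
    induction t with
    | zero => exact fun _ => ⟨_, 0, rfl, Nat.zero_le _, displays_init ha hW⟩
    | succ t ih =>
      intro ht
      obtain ⟨c, s, hr, hh, hd⟩ := ih (by omega)
      obtain ⟨c', hc', hd'⟩ := exists_displays_succ ha ht hd (by omega)
      rcases hc' with rfl | ⟨hne, hstep⟩
      · exact ⟨c', s, hr, by omega, hd'⟩
      · refine ⟨c', s + 1, ⟨c, hr, hstep⟩, ?_, hd'⟩
        rcases t with _ | t
        · rw [corner_eq ha hW] at hne
          exact absurd rfl hne
        · obtain ⟨q, b, d, -, rfl⟩ := hstep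
          cases d <;> simp only [moveHead] <;> omega
  obtain ⟨c, s, hr, -, hd⟩ := key (W - 1) (by omega)
  have hf : M.stateOf _ = M.accept := (ha.final 0 (W - 1) hW (by omega) (by omega)).2
  exact ⟨s, s, le_rfl, c, hr, hd.state.symm.trans hf⟩

/-! ### From computations to arrays -/

/-- One step of the machine, or no action at all. -/
def ActsBy (c c' : M.Cfg) : Option M.Action → Prop
  | none => c' = c
  | some (q, b, mv) => (q, b, mv.getD .left) ∈ M.δ c.state (c.tape c.head) ∧
      c' = ⟨q, moveHead (mv.getD .left) c.head, Function.update c.tape c.head b⟩ ∧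
      (mv = none → c.head = 0) ∧ (mv = some .left → c.head ≠ 0)

theorem Step.exists_actsBy {c c' : M.Cfg} (h : M.Step c c') : ∃ e, ActsBy c c' e := by
  obtain ⟨q, b, d, h, rfl⟩ := h
  cases d with
  | right => exact ⟨some (q, b, some .right), h, rfl, by simp, by simp⟩
  | left =>
    by_cases h0 : c.head = 0
    · exact ⟨some (q, b, none), h, rfl, fun _ => h0, by simp⟩
    · exact ⟨some (q, b, some .left), h, rfl, by simp, fun _ => h0⟩

theorem ReachesIn.exists_seq {s : ℕ} {c c' : M.Cfg} (h : M.ReachesIn s c c') :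
    ∃ f : ℕ → M.Cfg, f 0 = c ∧ (∀ t, s ≤ t → f t = c') ∧ ∀ t < s, M.Step (f t) (f (t + 1)) := by
  induction s generalizing c' with
  | zero => exact ⟨fun _ => c, rfl, fun _ _ => h, by simp⟩
  | succ s ih =>
    obtain ⟨c₁, h1, h2⟩ := h
    obtain ⟨f, hf0, hf1, hf2⟩ := ih h1
    refine ⟨fun t => if t ≤ s then f t else c', by simp [hf0], fun t ht => ?_, fun t ht => ?_⟩
    · exact if_neg (show ¬t ≤ s by omega)
    · rcases Nat.lt_succ_iff_lt_or_eq.1 ht with ht | rfl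
      · simp only [if_pos ht.le, if_pos (show t + 1 ≤ s from ht)]
        exact hf2 t ht
      · simp only [le_refl, if_true, if_neg (show ¬t + 1 ≤ t by omega)]
        rwa [hf1 t le_rfl]

/-- The array that displays a computation. -/
def computation (f : ℕ → M.Cfg) (e : ℕ → Option M.Action) (p t : ℕ) : M.Sym :=
  (match t with
    | 0 => none
    | t + 1 => some ((f t).state, e t),
   match p with
    | 0 => none
    | p + 1 => some ((f (t - 1)).tape p, compare p (f (t - 1)).head))

theorem symH_computation {f : ℕ → M.Cfg} {e : ℕ → Option M.Action} (hf : f 0 = M.init x)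
    (he : ∀ t, ActsBy (f t) (f (t + 1)) (e t)) (p t : ℕ) :
    M.SymH (computation f e p t) (computation f e (p + 1) t) := by
  refine ⟨rfl, _, _, rfl, ?_, ?_, ?_⟩
  · rcases p with _ | p
    · exact fun h => Nat.not_lt_zero _ (Nat.compare_eq_gt.1 h)
    · change Follows (some (compare p _)) _
      rcases lt_trichotomy p (f (t - 1)).head with h | h | h
      · rw [Nat.compare_eq_lt.2 h]
        intro h'
        have := Nat.compare_eq_gt.1 h'
        omega
      · rw [Nat.compare_eq_eq.2 h]
        exact Nat.compare_eq_gt.2 (by omega)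
      · rw [Nat.compare_eq_gt.2 h]
        exact Nat.compare_eq_gt.2 (by omega)
  · rcases t with _ | t
    · intro _ o' h
      rcases p with _ | p
      · simp [computation] at h
      · have h1 : (f 0).tape p = M.blank := congrArg Prod.fst (Option.some.inj h)
        change (f 0).tape (p + 1) = M.blank
        rw [hf] at h1 ⊢
        refine M.init_tape_of_le x ?_
        by_contra hlt
        simp only [init] at h1
        rw [List.getElem?_eq_getElem (by omega)] at h1
        exact M.bit_ne_blank _ h1
    · intro h
      simp [computation] at h
  · rcases t with _ | t
    · intro e h
      simp [computation, actionOf] at h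
    · rintro ⟨q, b, mv⟩ h ho
      have h : e t = some (q, b, mv) := h
      have ho : p = (f t).head := Nat.compare_eq_eq.1 ho
      have ht := he t
      rw [h] at ht
      obtain ⟨-, -, h1, h2⟩ := ht
      rw [← ho] at h1 h2
      rcases p with _ | p
      · exact ⟨fun _ => rfl, fun h => absurd rfl (h2 h)⟩
      · exact ⟨fun h => absurd (h1 h) (by simp), fun _ => by simp [computation]⟩

theorem symV_computation {f : ℕ → M.Cfg} {e : ℕ → Option M.Action} (hf : f 0 = M.init x)
    (he : ∀ t, ActsBy (f t) (f (t + 1)) (e t)) (p t : ℕ) :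
    M.SymV (computation f e p t) (computation f e p (t + 1)) := by
  rcases t with _ | t
  · refine ⟨by simp [computation], ?_, ?_, fun _ => rfl, ?_⟩
    · change (f 0).state = M.start
      rw [hf]
      rfl
    · rcases p with _ | p
      · exact fun _ => rfl
      · intro h
        simp [computation] at h
    · intro _ _ _ h
      simp [computation, actionOf] at h
  · have hact : M.actionOf (computation f e p (t + 1)).1 = e t := rfl
    have ht := he t
    refine ⟨by simp [computation], ?_, ?_, ?_, ?_⟩
    · rw [hact]
      change (f (t + 1)).state = ((e t).map Prod.fst).getD (f t).state
      rcases h : e t with _ | ⟨q, b, mv⟩ <;> rw [h] at ht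
      · rw [show f (t + 1) = f t from ht]
        rfl
      · rw [ht.2.1]
        rfl
    · rcases p with _ | p
      · exact fun _ => rfl
      · intro h
        simp [computation] at h
    · rw [hact]
      intro h
      rw [h] at ht
      rcases p with _ | p
      · rfl
      · change some ((f (t + 1)).tape p, compare p (f (t + 1)).head) = _
        rw [show f (t + 1) = f t from ht]
        rfl
    · rw [hact]
      rintro ⟨q, b, mv⟩ s o h hs
      rw [h] at ht
      obtain ⟨h1, h2, h3, h4⟩ := ht
      rcases p with _ | p
      · simp [computation] at hs
      · obtain ⟨rfl, rfl⟩ : (f t).tape p = s ∧ compare p (f t).head = o := by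
          simpa [computation] using hs
        refine ⟨_, _, rfl, ?_, ?_, ?_⟩
        · change Moves mv _ (compare p (f (t + 1)).head)
          rw [h2]
          simp only
          rcases mv with _ | _ | _
          · rw [h3 rfl]
            rfl
          · have h0 := h4 rfl
            simp only [moveHead, Option.getD_some]
            rcases lt_trichotomy p (f t).head with h | h | h
            · rw [Nat.compare_eq_lt.2 h]
              intro h'
              have := Nat.compare_eq_gt.1 h'
              omega
            · rw [Nat.compare_eq_eq.2 h]
              exact Nat.compare_eq_gt.2 (by omega)
            · rw [Nat.compare_eq_gt.2 h]
              exact Nat.compare_eq_gt.2 (by omega)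
          · simp only [moveHead, Option.getD_some]
            rcases lt_trichotomy p (f t).head with h | h | h
            · rw [Nat.compare_eq_lt.2 h]
              exact Nat.compare_eq_lt.2 (by omega)
            · rw [Nat.compare_eq_eq.2 h]
              exact Nat.compare_eq_lt.2 (by omega)
            · rw [Nat.compare_eq_gt.2 h]
              intro h'
              have := Nat.compare_eq_lt.1 h'
              omega
        · intro hne
          change (f (t + 1)).tape p = _
          rw [h2]
          exact Function.update_of_ne (fun h => hne (Nat.compare_eq_eq.2 h)) _ _
        · intro heq
          have hp : p = (f t).head := Nat.compare_eq_eq.1 heq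
          refine ⟨?_, ?_⟩
          · change (f (t + 1)).tape p = _
            rw [h2, hp]
            exact Function.update_self _ _ _
          · rw [hp]
            exact h1

/-- After acceptance the machine idles by the action `none`. Row `t + 1` displays configuration `t`,
so the final row `W - 1` displays configuration `W - 2 ≥ T`. -/
theorem AcceptsWithin.exists_isArray {T X W : ℕ} (h : M.AcceptsWithin x T) (hT : T + 2 ≤ W) :
    ∃ a, M.arraySystem.IsArray X W (M.initConditions x) a := by
  obtain ⟨s, hs, c, hr, hc⟩ := h
  obtain ⟨f, hf0, hf1, hf2⟩ := hr.exists_seq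
  have hex : ∀ t, ∃ e, ActsBy (f t) (f (t + 1)) e := by
    intro t
    rcases Nat.lt_or_ge t s with h | h
    · exact (hf2 t h).exists_actsBy
    · exact ⟨none, by rw [ActsBy, hf1 t h, hf1 (t + 1) (by omega)]⟩
  choose e he using hex
  refine ⟨computation f e, fun p t _ _ => symH_computation hf0 he p t,
    fun p t _ _ => symV_computation hf0 he p t, fun p _ i hi => ?_, fun p t _ _ ht => ?_⟩
  · rcases p with _ | p
    · obtain rfl := (Option.some.inj hi).symm
      rfl
    · have hi : (M.initConditions x)[p + 1]? = some i := hi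
      rcases Nat.lt_or_ge x.length p with h | h
      · rw [List.getElem?_eq_none (by simp [initConditions]; omega)] at hi
        simp at hi
      · rw [M.initConditions_getElem? x h] at hi
        obtain rfl := (Option.some.inj hi).symm
        refine ⟨compare p (f 0).head, ?_, by rw [← hf0]; rfl⟩
        rw [hf0, ne_eq, Nat.compare_eq_lt]
        exact Nat.not_lt_zero p
  · obtain ⟨t, rfl⟩ : ∃ u, t = u + 1 := ⟨t - 1, by omega⟩
    refine ⟨by simp [computation], ?_⟩
    change (f t).state = M.accept
    rw [hf1 t (by omega), hc]

/-- Membership in a language accepted in time `2 ^ p` is a tiling problem. -/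
theorem AcceptsInTime.mem_iff_word_mem {L : Language Bool} {p : ℕ → ℕ}
    (h : M.AcceptsInTime L fun n => 2 ^ p n) (c : M.arraySystem.Coding) {q : ℕ}
    (hq : p x.length ≤ q) :
    x ∈ L ↔ c.word (M.initConditions x) q ∈ universalSystem.toTilingSystem.TILING := by
  have hK := c.two_le
  -- The `q` padding blocks push `code` up to `2 ^ ((5 + q) * K) ≥ 2 ^ (q + 4) * K`, which leaves
  -- room after division by `K` and removal of five blocks.
  have hW : 2 ^ q + 2 ≤ c.code (M.initConditions x) q / c.K - 5 := by
    have h1 : 2 ^ (q + 4) * c.K ≤ c.code (M.initConditions x) q := by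
      refine le_trans ?_ (c.two_pow_le_code _ q)
      calc 2 ^ (q + 4) * c.K ≤ 2 ^ (q + 4) * 2 ^ c.K :=
            Nat.mul_le_mul_left _ Nat.lt_two_pow_self.le
        _ = 2 ^ (q + 4 + c.K) := (pow_add _ _ _).symm
        _ ≤ 2 ^ ((5 + q) * c.K) := Nat.pow_le_pow_right (by norm_num) (by nlinarith)
    have h2 := (Nat.le_div_iff_mul_le (by omega)).2 h1
    have h3 : 2 ^ (q + 4) = 16 * 2 ^ q := by rw [pow_add]; ring
    have := Nat.one_le_two_pow (n := q)
    omega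
  constructor
  · intro hx
    obtain ⟨a, ha⟩ := (h.2 x hx).exists_isArray
      (X := c.code (M.initConditions x) q + 1) (W := c.code (M.initConditions x) q / c.K - 5)
      (le_trans (Nat.add_le_add_right (Nat.pow_le_pow_right (by norm_num) hq) 2) hW)
    exact c.word_mem_of_isArray ha
  · intro hx
    obtain ⟨a, ha⟩ := c.exists_isArray_of_word_mem hx
    exact (h.1 x).2 (acceptsWithin_of_isArray ha (le_trans (by simp) hW))

end NTM

/-! ### A polynomial-time padding machine -/

namespace PaddingMachine

open Turing Turing.TM2.Stmt

/-- The stacks of the padding machine. -/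
inductive Stack
  | inp | rev | out | ctr | aux | work
  deriving DecidableEq

instance : Fintype Stack :=
  ⟨{.inp, .rev, .out, .ctr, .aux, .work}, fun x => by cases x <;> decide⟩

/-- The labels of the padding machine. -/
inductive Label
  | copy | loop | scan | back | emit | clear
  deriving DecidableEq

instance : Fintype Label :=
  ⟨{.copy, .loop, .scan, .back, .emit, .clear}, fun x => by cases x <;> decide⟩

/-- The stack alphabets: levels on the work stack, and bits elsewhere. -/
abbrev Alphabet (d : ℕ) : Stack → Type
  | .work => Fin (d + 1)
  | _ => Bool

/-- The registers: the last bit and the last level read. -/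
abbrev Reg (d : ℕ) : Type := Option Bool × Option (Fin (d + 1))

variable {d : ℕ}

/-- The stack contents. -/
def stk (i r o c a : List Bool) (w : List (Fin (d + 1))) : ∀ k, List (Alphabet d k)
  | .inp => i
  | .rev => r
  | .out => o
  | .ctr => c
  | .aux => a
  | .work => w

section

variable (i r o c a l : List Bool) (w l' : List (Fin (d + 1)))

@[simp] theorem stk_inp : stk i r o c a w .inp = i := rfl
@[simp] theorem stk_rev : stk i r o c a w .rev = r := rfl
@[simp] theorem stk_out : stk i r o c a w .out = o := rfl
@[simp] theorem stk_ctr : stk i r o c a w .ctr = c := rfl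
@[simp] theorem stk_aux : stk i r o c a w .aux = a := rfl
@[simp] theorem stk_work : stk i r o c a w .work = w := rfl

@[simp] theorem update_inp : Function.update (stk i r o c a w) .inp l = stk l r o c a w := by
  funext k; cases k <;> rfl
@[simp] theorem update_rev : Function.update (stk i r o c a w) .rev l = stk i l o c a w := by
  funext k; cases k <;> rfl
@[simp] theorem update_out : Function.update (stk i r o c a w) .out l = stk i r l c a w := by
  funext k; cases k <;> rfl
@[simp] theorem update_ctr : Function.update (stk i r o c a w) .ctr l = stk i r o l a w := by
  funext k; cases k <;> rfl
@[simp] theorem update_aux : Function.update (stk i r o c a w) .aux l = stk i r o c l w := by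
  funext k; cases k <;> rfl
@[simp] theorem update_work : Function.update (stk i r o c a w) .work l' = stk i r o c a l' := by
  funext k; cases k <;> rfl

end

/-- Push the word `l` on top of a stack. -/
def pushWord (k : Stack) (l : List (Alphabet d k)) (q : TM2.Stmt (Alphabet d) Label (Reg d)) :
    TM2.Stmt (Alphabet d) Label (Reg d) :=
  l.foldl (fun q a => push k (fun _ => a) q) q

@[simp] theorem stepAux_pushWord (k : Stack) (l : List (Alphabet d k))
    (q : TM2.Stmt (Alphabet d) Label (Reg d)) (v : Reg d) (S : ∀ k, List (Alphabet d k)) :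
    TM2.stepAux (pushWord k l q) v S = TM2.stepAux q v (Function.update S k (l ++ S k)) := by
  induction l generalizing q S with
  | nil => simp [pushWord]
  | cons x l ih =>
    rw [pushWord, List.foldl_cons, ← pushWord, ih]
    simp

/-- The data of the padding machine: words put in front, for each bit, after the input, as unit of
padding, and at the end; a number added to the length of the input, and the degree. -/
structure Data where
  /-- the word in front -/
  pre : List Bool
  /-- the word for a bit -/
  sub : Bool → List Bool
  /-- the word after the input -/
  mid : List Bool
  /-- the unit of padding -/
  unit : List Bool
  /-- the final word -/
  suf : List Bool
  /-- the number added to the length -/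
  shift : ℕ
  /-- the degree -/
  deg : ℕ

namespace Data

variable (D : Data)

/-- The function computed by the padding machine. -/
def fn (x : List Bool) : List Bool :=
  D.pre ++ x.flatMap D.sub ++ D.mid ++
    (List.replicate ((x.length + D.shift) ^ D.deg) D.unit).flatten ++ D.suf

/-- The program of the padding machine. -/
def program : Label → TM2.Stmt (Alphabet D.deg) Label (Reg D.deg)
  | .copy => pop .inp (fun v s => (s, v.2)) <| branch (fun v => v.1.isSome)
      (push .rev (fun v => v.1.getD false) <| push .ctr (fun _ => true) <| goto fun _ => .copy)
      (pushWord .ctr (List.replicate D.shift true) <| pushWord .out D.suf <|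
        push .work (fun _ => Fin.last D.deg) <| goto fun _ => .loop)
  | .loop => pop .work (fun v s => (v.1, s)) <| branch (fun v => v.2.isSome)
      (branch (fun v => v.2 == some 0) (pushWord .out D.unit <| goto fun _ => .loop)
        (goto fun _ => .scan))
      (pushWord .out D.mid <| goto fun _ => .emit)
  | .scan => pop .ctr (fun v s => (s, v.2)) <| branch (fun v => v.1.isSome)
      (push .aux (fun _ => true) <|
        push .work (fun v => v.2.elim 0 fun l => ⟨l - 1, by omega⟩) <| goto fun _ => .scan)
      (goto fun _ => .back)
  | .back => pop .aux (fun v s => (s, v.2)) <| branch (fun v => v.1.isSome)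
      (push .ctr (fun _ => true) <| goto fun _ => .back)
      (goto fun _ => .loop)
  | .emit => pop .rev (fun v s => (s, v.2)) <| branch (fun v => v.1.isSome)
      (branch (fun v => v.1.getD false) (pushWord .out (D.sub true) <| goto fun _ => .emit)
        (pushWord .out (D.sub false) <| goto fun _ => .emit))
      (pushWord .out D.pre <| goto fun _ => .clear)
  | .clear => pop .ctr (fun v s => (s, v.2)) <| branch (fun v => v.1.isSome)
      (goto fun _ => .clear)
      (load (fun _ => (none, none)) halt)

/-- The padding machine. -/
def machine : FinTM2 where
  K := Stack
  k₀ := .inp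
  k₁ := .out
  Γ := Alphabet D.deg
  Λ := Label
  main := .copy
  σ := Reg D.deg
  initialState := (none, none)
  Γk₀Fin := inferInstanceAs (Fintype Bool)
  m := D.program

/-- The machine gets from `c` to `c'` in `n` steps. -/
def Run (n : ℕ) (c c' : TM2.Cfg (Alphabet D.deg) Label (Reg D.deg)) : Prop :=
  (flip bind (TM2.step D.program))^[n] (some c) = some c'

/-! ### Runs of the padding machine and their exact lengths -/

variable {D}

theorem Run.trans {m n : ℕ} {a b c : TM2.Cfg (Alphabet D.deg) Label (Reg D.deg)}
    (h : D.Run m a b) (h' : D.Run n b c) : D.Run (m + n) a c := by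
  rw [Run, add_comm, Function.iterate_add_apply, h]
  exact h'

theorem Run.of_step {n : ℕ} {a b c : TM2.Cfg (Alphabet D.deg) Label (Reg D.deg)}
    (h : TM2.step D.program a = some b) (h' : D.Run n b c) : D.Run (n + 1) a c := by
  rw [add_comm]
  exact Run.trans (m := 1) h h'

theorem Run.single {a b : TM2.Cfg (Alphabet D.deg) Label (Reg D.deg)}
    (h : TM2.step D.program a = some b) : D.Run 1 a b := h

theorem run_copy (i r c : List Bool) (v : Reg D.deg) :
    ∃ v', D.Run (i.length + 1) ⟨some .copy, v, stk i r [] c [] []⟩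
      ⟨some .loop, v', stk [] (i.reverse ++ r) D.suf
        (List.replicate D.shift true ++ (List.replicate i.length true ++ c)) []
        [Fin.last D.deg]⟩ := by
  induction i generalizing r c v with
  | nil => exact ⟨_, Run.single (by simp [program, TM2.step]; rfl)⟩
  | cons b i ih =>
    obtain ⟨v', h⟩ := ih (b :: r) (true :: c) (some b, v.2)
    refine ⟨v', ?_⟩
    refine Run.of_step (b := ⟨some .copy, (some b, v.2), stk i (b :: r) [] (true :: c) [] []⟩) ?_ ?_
    · simp [program, TM2.step]
    · rw [List.length_cons, List.replicate_succ', List.append_assoc, List.reverse_cons,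
        List.append_assoc]
      exact h

/-- The unary counter moves to the auxiliary stack, and each unit leaves one element of the next
lower level on the work stack. -/
theorem run_scan (r o : List Bool) (l : Fin D.deg) (k j : ℕ) (v : Option Bool)
    (w : List (Fin (D.deg + 1))) :
    ∃ v', D.Run (k + 1)
      ⟨some .scan, (v, some l.succ), stk [] r o (List.replicate k true) (List.replicate j true) w⟩
      ⟨some .back, v', stk [] r o [] (List.replicate (k + j) true)
        (List.replicate k l.castSucc ++ w)⟩ := by
  induction k generalizing j w v with
  | zero => exact ⟨_, Run.single (by simp [program, TM2.step]; rfl)⟩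
  | succ k ih =>
    obtain ⟨v', h⟩ := ih (j + 1) (some true) (l.castSucc :: w)
    refine ⟨v', ?_⟩
    refine Run.of_step (b := ⟨some .scan, (some true, some l.succ), stk [] r o
      (List.replicate k true) (List.replicate (j + 1) true) (l.castSucc :: w)⟩) ?_ ?_
    · simp [program, TM2.step, List.replicate_succ]
      rfl
    · convert h using 3
      · rw [add_right_comm, add_assoc]
      · simp [List.replicate_succ']

theorem run_back (r o : List Bool) (k j : ℕ) (v : Reg D.deg) (w : List (Fin (D.deg + 1))) :
    ∃ v', D.Run (k + 1)
      ⟨some .back, v, stk [] r o (List.replicate j true) (List.replicate k true) w⟩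
      ⟨some .loop, v', stk [] r o (List.replicate (k + j) true) [] w⟩ := by
  induction k generalizing j v with
  | zero => exact ⟨_, Run.single (by simp [program, TM2.step]; rfl)⟩
  | succ k ih =>
    obtain ⟨v', h⟩ := ih (j + 1) (some true, v.2)
    refine ⟨v', ?_⟩
    refine Run.of_step (b := ⟨some .back, (some true, v.2), stk [] r o
      (List.replicate (j + 1) true) (List.replicate k true) w⟩) ?_ ?_
    · simp [program, TM2.step, List.replicate_succ]
    · convert h using 3
      rw [add_right_comm, add_assoc]

/-- The time needed for an element of a given level on the work stack. -/
def levelTime (m : ℕ) : ℕ → ℕ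
  | 0 => 1
  | l + 1 => m * levelTime m l + (m + 1) + (m + 1) + 1

/-- An element of level `l + 1` is replaced by `m` elements of level `l`, and level 0 emits one
unit; so level `l` emits `m ^ l` units. The work stack thus serves as a recursion stack. -/
theorem run_level (r : List Bool) (m : ℕ) (l : ℕ) (hl : l < D.deg + 1) (o : List Bool)
    (v : Reg D.deg) (w : List (Fin (D.deg + 1))) :
    ∃ v', D.Run (levelTime m l)
      ⟨some .loop, v, stk [] r o (List.replicate m true) [] (⟨l, hl⟩ :: w)⟩
      ⟨some .loop, v', stk [] r ((List.replicate (m ^ l) D.unit).flatten ++ o)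
        (List.replicate m true) [] w⟩ := by
  induction l generalizing o v w with
  | zero =>
    exact ⟨_, Run.single (by simp [program, TM2.step]; rfl)⟩
  | succ l ih =>
    have hcopies : ∀ (k : ℕ) (o : List Bool) (v : Reg D.deg),
        ∃ v', D.Run (k * levelTime m l)
          ⟨some .loop, v, stk [] r o (List.replicate m true) []
            (List.replicate k ⟨l, by omega⟩ ++ w)⟩
          ⟨some .loop, v', stk [] r ((List.replicate (k * m ^ l) D.unit).flatten ++ o)
            (List.replicate m true) [] w⟩ := by
      intro k
      induction k with
      | zero => exact fun o v => ⟨v, by simp [Run]⟩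
      | succ k ihk =>
        intro o v
        obtain ⟨v₁, h₁⟩ := ih (by omega) o v (List.replicate k ⟨l, by omega⟩ ++ w)
        obtain ⟨v₂, h₂⟩ := ihk ((List.replicate (m ^ l) D.unit).flatten ++ o) v₁
        refine ⟨v₂, ?_⟩
        have h := h₁.trans h₂
        rw [← List.append_assoc, ← List.flatten_append, List.replicate_append_replicate] at h
        rwa [add_mul, one_mul, add_mul, one_mul, add_comm (k * _), List.replicate_succ]
    obtain ⟨v₁, h₁⟩ := run_scan (D := D) r o ⟨l, by omega⟩ m 0 v.1 w
    obtain ⟨v₂, h₂⟩ := run_back (D := D) r o m 0 v₁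
      (List.replicate m (Fin.castSucc ⟨l, by omega⟩) ++ w)
    obtain ⟨v₃, h₃⟩ := hcopies m o v₂
    refine ⟨v₃, ?_⟩
    have h := (h₁.trans h₂).trans h₃
    rw [levelTime, pow_succ']
    have e : m * levelTime m l + (m + 1) + (m + 1) = m + 1 + (m + 1) + m * levelTime m l := by ring
    rw [e]
    refine Run.of_step ?_ h
    have hne : ((⟨l + 1, hl⟩ : Fin (D.deg + 1)) == 0) = false := by
      simp [Fin.ext_iff]
    simp [program, TM2.step, hne]

theorem run_emit (r o c : List Bool) (v : Reg D.deg) :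
    ∃ v', D.Run (r.length + 1) ⟨some .emit, v, stk [] r o c [] []⟩
      ⟨some .clear, v', stk [] [] (D.pre ++ (r.reverse.flatMap D.sub ++ o)) c [] []⟩ := by
  induction r generalizing o v with
  | nil => exact ⟨_, Run.single (by simp [program, TM2.step]; rfl)⟩
  | cons b r ih =>
    obtain ⟨v', h⟩ := ih (D.sub b ++ o) (some b, v.2)
    refine ⟨v', ?_⟩
    refine Run.of_step (b := ⟨some .emit, (some b, v.2), stk [] r (D.sub b ++ o) c [] []⟩) ?_ ?_
    · cases b <;> simp [program, TM2.step]
    · simpa using h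

/-- The prescribed halting configuration has all stacks empty except the output, so the counter must
be discarded. -/
theorem run_clear (o c : List Bool) (v : Reg D.deg) :
    D.Run (c.length + 1) ⟨some .clear, v, stk [] [] o c [] []⟩
      ⟨none, (none, none), stk [] [] o [] [] []⟩ := by
  induction c generalizing v with
  | nil => exact Run.single (by simp [program, TM2.step])
  | cons b c ih =>
    refine Run.of_step ?_ (ih (some b, v.2))
    simp [program, TM2.step]

/-- The time needed for an element of a given level, as a polynomial. -/
noncomputable def levelPoly (m : Polynomial ℕ) : ℕ → Polynomial ℕ
  | 0 => 1
  | l + 1 => m * levelPoly m l + (m + 1) + (m + 1) + 1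

theorem levelPoly_eval (m : Polynomial ℕ) (n l : ℕ) :
    (levelPoly m l).eval n = levelTime (m.eval n) l := by
  induction l with
  | zero => simp [levelPoly, levelTime]
  | succ l ih => simp [levelPoly, levelTime, ih]

/-- The running time of the padding machine. -/
noncomputable def time (D : Data) : Polynomial ℕ :=
  Polynomial.X + 1 + levelPoly (Polynomial.X + (D.shift : Polynomial ℕ)) D.deg + 1 +
    (Polynomial.X + 1) + (Polynomial.X + (D.shift : Polynomial ℕ) + 1)

theorem time_eval (D : Data) (n : ℕ) : D.time.eval n =
    n + 1 + levelTime (n + D.shift) D.deg + 1 + (n + 1) + (n + D.shift + 1) := by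
  simp [time, levelPoly_eval]

/-- The output is a stack and is written from its end: `suf`, padding, `mid`, then the words for the
input bits taken from the reversed input, and `pre`. -/
theorem run_machine (x : List Bool) :
    D.Run (D.time.eval x.length) ⟨some .copy, (none, none), stk x [] [] [] [] []⟩
      ⟨none, (none, none), stk [] [] (D.fn x) [] [] []⟩ := by
  obtain ⟨v₁, h₁⟩ := run_copy (D := D) x [] [] (none, none)
  obtain ⟨v₂, h₂⟩ := run_level (D := D) x.reverse (x.length + D.shift) D.deg (by omega) D.suf v₁ []
  rw [List.append_nil, List.append_nil, List.replicate_append_replicate, add_comm D.shift] at h₁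
  have h₃ : D.Run 1 ⟨some .loop, v₂, stk [] x.reverse
      ((List.replicate ((x.length + D.shift) ^ D.deg) D.unit).flatten ++ D.suf)
        (List.replicate (x.length + D.shift) true) [] []⟩
      ⟨some .emit, (v₂.1, none), stk [] x.reverse
        (D.mid ++ ((List.replicate ((x.length + D.shift) ^ D.deg) D.unit).flatten ++ D.suf))
        (List.replicate (x.length + D.shift) true) [] []⟩ :=
    Run.single (by simp [program, TM2.step])
  obtain ⟨v₄, h₄⟩ := run_emit (D := D) x.reverse
    (D.mid ++ ((List.replicate ((x.length + D.shift) ^ D.deg) D.unit).flatten ++ D.suf))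
    (List.replicate (x.length + D.shift) true) (v₂.1, none)
  have h := (((h₁.trans h₂).trans h₃).trans h₄).trans (run_clear _ _ v₄)
  rw [time_eval]
  simpa [fn] using h

theorem initList_machine (x : List Bool) :
    initList D.machine x = ⟨some .copy, (none, none), stk x [] [] [] [] []⟩ := by
  unfold initList
  congr 1
  funext k
  cases k <;> rfl

theorem haltList_machine (x : List Bool) :
    haltList D.machine x = ⟨none, (none, none), stk [] [] x [] [] []⟩ := by
  unfold haltList
  congr 1
  funext k
  cases k <;> rfl

/-- The padding machine computes its function in polynomial time. -/
theorem nonempty_computable (D : Data) :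
    Nonempty (TM2ComputableInPolyTime (id : List Bool → List Bool) id D.fn) := by
  refine ⟨{
    tm := D.machine
    inputAlphabet := Equiv.refl Bool
    outputAlphabet := Equiv.refl Bool
    time := D.time
    outputsFun := fun x => {
      steps := D.time.eval x.length
      evals_in_steps := ?_
      steps_le_m := le_rfl } }⟩
  have h₀ : initList D.machine (List.map (Equiv.refl Bool).invFun x) = _ :=
    (congrArg _ (List.map_id x)).trans (initList_machine x)
  have h₁ : haltList D.machine (List.map (Equiv.refl Bool).invFun (D.fn x)) = _ :=
    (congrArg _ (List.map_id _)).trans (haltList_machine _)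
  have h : (flip bind D.machine.step)^[D.time.eval x.length]
      (some (initList D.machine (List.map (Equiv.refl Bool).invFun x))) =
        some (haltList D.machine (List.map (Equiv.refl Bool).invFun (D.fn x))) := by
    rw [h₀, h₁]
    exact run_machine x
  exact h

end Data

end PaddingMachine

/-! ### Hardness -/

open ArraySystem in
/-- The reduction of a language in `NEXP` to the tiling problem of the universal system. -/
theorem polyTimeReducible_universalSystem {L : Language Bool} (hL : L ∈ NEXP) :
    PolyTimeReducible L universalSystem.toTilingSystem.TILING := by
  obtain ⟨p, M, hM⟩ := Set.mem_iUnion.1 hL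
  obtain ⟨c, d, hcd⟩ := exists_eval_le_pow p
  obtain ⟨cd⟩ := exists_coding M.arraySystem
  let I₀ : ℕ → Bool := cd.initBlock fun c => c = (none, none)
  -- Only the middle of the word depends on `x`. The prefix holds the two altered lowest digits, the
  -- rest of the five tables, and the block for the wall.
  let D : PaddingMachine.Data :=
    { pre := true :: true ::
        (blockWord cd.K [cd.tab 0, cd.tab 1, cd.tab 2, cd.tab 3, cd.tab 4, I₀]).drop 2
      sub := fun b => (List.range cd.K).map (cd.initBlock (M.InitCell (M.bit b)))
      mid := (List.range cd.K).map (cd.initBlock (M.InitCell M.blank))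
      unit := (List.range cd.K).map fun _ => false
      suf := (List.range cd.K).map fun r => decide (r = cd.K - 1)
      shift := c
      deg := d }
  refine ⟨D.fn, D.nonempty_computable, fun x => ?_⟩
  have hfn : D.fn x = cd.word (M.initConditions x) ((x.length + c) ^ d) := by
    have hK := cd.two_le
    have hb : cd.blocks (M.initConditions x) ((x.length + c) ^ d) =
        [cd.tab 0, cd.tab 1, cd.tab 2, cd.tab 3, cd.tab 4, I₀] ++
          (x.map (fun b => cd.initBlock (M.InitCell (M.bit b))) ++
          ([cd.initBlock (M.InitCell M.blank)] ++
          (List.replicate ((x.length + c) ^ d) (fun _ => false) ++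
            [fun r => decide (r = cd.K - 1)]))) := by
      have hmap : ∀ (f : (M.arraySystem.A → Prop) → ℕ → Bool) (i j) (g : Bool → _),
          ([i] ++ x.map g ++ [j]).map f = [f i] ++ x.map (fun b => f (g b)) ++ [f j] := by
        intros
        simp
      have := hmap cd.initBlock (fun c => c = (none, none)) (M.InitCell M.blank)
        fun b => M.InitCell (M.bit b)
      unfold Coding.blocks
      rw [show (M.initConditions x).map cd.initBlock = _ from this]
      simp [I₀]
    unfold Coding.word
    rw [hb, blockWord, List.flatMap_append, ← blockWord, ← blockWord,
      List.drop_append_of_le_length (by rw [length_blockWord]; simp; omega)]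
    simp [PaddingMachine.Data.fn, D, blockWord, List.flatMap_map, List.flatMap_replicate]
  rw [hfn]
  exact hM.mem_iff_word_mem cd (hcd x.length)

/-! ### A nondeterministic machine for the tiling problem -/

namespace TilingSystem

/-- The tape alphabet of the verifier: blanks, input bits, and cells that hold the flags for the
first and the last column, a tile, a digit of the number of remaining rows, and a flag for the
column whose index is that of the current row. -/
inductive Symbol (S : TilingSystem)
  | blank
  | raw (d : Bool)
  | cell (first last : Bool) (t : S.Tile) (digit mark : Bool)

/-- The states of the verifier: sweeping right (with the tile to the left, the borrow, the flag for
the final row, the next mark, and whether the input read so far ends with `true`), turning around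
behind the last column, going back to the left, and accepting. -/
inductive VState (S : TilingSystem)
  | right (prev : Option S.Tile) (borrow fin mark ok : Bool)
  | turn (fin ok : Bool)
  | left
  | accept

variable {S : TilingSystem}

instance : Finite S.Symbol :=
  have := S.finTile
  Finite.of_injective (β := Option (Bool ⊕ Bool × Bool × S.Tile × Bool × Bool))
    (fun
      | .blank => none
      | .raw d => some (.inl d)
      | .cell a b t d m => some (.inr (a, b, t, d, m)))
    (by rintro (_ | _ | _) (_ | _ | _) h <;> simp_all)

instance : Finite S.VState :=
  have := S.finTile
  Finite.of_injective (β := Option (Option ((Option S.Tile × Bool × Bool × Bool × Bool) ⊕ Bool × Bool)))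
    (fun
      | .right p b f m o => some (some (.inl (p, b, f, m, o)))
      | .turn f o => some (some (.inr (f, o)))
      | .left => some none
      | .accept => none)
    (by rintro (_ | _ | _ | _) (_ | _ | _ | _) h <;> simp_all)

namespace Symbol

/-- The binary digit in a cell. -/
def digit : S.Symbol → Bool
  | blank => false
  | raw d => d
  | cell _ _ _ d _ => d

/-- The mark in a cell. -/
def mark : S.Symbol → Bool
  | cell _ _ _ _ m => m
  | _ => false

/-- The tile in a cell. -/
def tile : S.Symbol → Option S.Tile
  | cell _ _ t _ _ => some t
  | _ => none

/-- The flag for the last column. -/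
def last : S.Symbol → Option Bool
  | cell _ l _ _ _ => some l
  | _ => none

/-- The update of the record whether the input read so far ends with `true`. -/
def ok (o : Bool) : S.Symbol → Bool
  | raw d => d
  | _ => o

end Symbol

/-- The moves of the verifier. -/
inductive Move (S : TilingSystem) :
    S.VState → S.Symbol → S.VState → S.Symbol → Turing.Dir → Prop
  | sweep {prev : Option S.Tile} {b fin m o : Bool} {a : S.Symbol} (fin' last : Bool) (t : S.Tile)
      (fin_eq : prev = none ∨ fin' = fin)
      (horizontal : ∀ s ∈ prev, (s, t) ∈ S.H)
      (vertical : ∀ s ∈ a.tile, (s, t) ∈ S.V)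
      (last_eq : ∀ l ∈ a.last, last = l)
      (corner : prev = none ∨ last = true → a.tile = none ∨ fin' = true → t = S.corner)
      (digit_eq : fin' = true → (a.digit ^^ b) = false)
      (mark_eq : fin' = true → last = true → m = true)
      (borrow_eq : last = true → (b && !a.digit) = false)
      (ok_eq : a = .blank → o = true) :
      Move S (.right prev b fin m o) a
        (bif last then .turn fin' (a.ok o)
          else .right (some t) (b && !a.digit) fin' a.mark (a.ok o))
        (.cell prev.isNone last t (a.digit ^^ b) m) .right
  | accept : Move S (.turn true true) .blank .accept .blank .left
  | back : Move S (.turn false true) .blank .left .blank .left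
  | left (l : Bool) (t : S.Tile) (d m : Bool) :
      Move S .left (.cell false l t d m) .left (.cell false l t d m) .left
  | again (l : Bool) (t : S.Tile) (d m : Bool) :
      Move S .left (.cell true l t d m) (.right none true false false true)
        (.cell true l t d m) .left

/-- A machine that guesses a tiling row by row. -/
def verifier (S : TilingSystem) : NTM where
  Q := S.VState
  Γ := S.Symbol
  blank := .blank
  bit := .raw
  bit_injective _ _ h := by injection h
  bit_ne_blank _ h := by injection h
  start := .right none true false true false
  accept := .accept
  δ q a := {x | S.Move q a x.1 x.2.1 x.2.2}

theorem verifier_step_iff {c c' : S.verifier.Cfg} :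
    S.verifier.Step c c' ↔ ∃ q b d, S.Move c.state (c.tape c.head) q b d ∧
      c' = ⟨q, NTM.moveHead d c.head, Function.update c.tape c.head b⟩ := Iff.rfl

/-! ### Configurations met while a tiling is written -/

section Configurations

variable (w : List Bool) (W : ℕ) (f : ℕ → ℕ → S.Tile) (k i : ℕ) (fin : Bool)

/-- Digit `i` of the counter after row `k` has been written. -/
def digitAfter : Bool :=
  (bitsVal w - k).testBit i ^^ decide ((bitsVal w - k) % 2 ^ i = 0)

/-- The cell in column `i` after row `k` has been written. -/
def newCell : S.Symbol :=
  .cell (decide (i = 0)) (decide (i + 1 = W)) (f i k) (digitAfter w k i) (decide (i = k))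

/-- The cell in column `i` before row `k` has been written. -/
def oldCell : ℕ → ℕ → S.Symbol
  | 0, i => (w[i]?).elim .blank .raw
  | k + 1, i => if i < W then newCell w W f k i else .blank

/-- The tape when the first `i` columns of row `k` have been written. -/
def sweepTape (j : ℕ) : S.Symbol :=
  if j < i then newCell w W f k j else oldCell w W f k j

/-- Whether the input read before column `i` in sweep `k` ends with `true`. -/
def okBefore : Bool := decide (k ≠ 0 ∨ (w.take i).getLast? = some true)

/-- The configuration when the first `i` columns of row `k` have been written. -/
def rightCfg : S.verifier.Cfg where
  state := VState.right (if i = 0 then none else some (f (i - 1) k))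
    (decide ((bitsVal w - k) % 2 ^ i = 0)) fin (decide (i = k)) (okBefore w k i)
  head := i
  tape := sweepTape w W f k i

/-- The configuration when row `k` has been written. -/
def turnCfg : S.verifier.Cfg where
  state := VState.turn fin (okBefore w k W)
  head := W
  tape := sweepTape w W f k W

/-- A configuration between two sweeps. -/
def leftCfg : S.verifier.Cfg where
  state := VState.left
  head := i
  tape := oldCell w W f k

end Configurations

variable {w : List Bool} {W k i : ℕ} {f : ℕ → ℕ → S.Tile} {fin : Bool}

/-- The bound on `k` excludes underflow: decrementing 0 yields digits that are all 1, while
truncated subtraction yields 0. -/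
theorem digitAfter_eq_testBit (hk : k < bitsVal w) (i : ℕ) :
    digitAfter w k i = (bitsVal w - (k + 1)).testBit i := by
  rw [testBit_eq_xor_succ, digitAfter, show bitsVal w - (k + 1) + 1 = bitsVal w - k by omega]

theorem digit_oldCell (hk : k ≤ bitsVal w) (hi : i < W) :
    (oldCell w W f k i).digit = (bitsVal w - k).testBit i := by
  cases k with
  | zero =>
    rw [Nat.sub_zero, testBit_bitsVal]
    simp only [oldCell]
    cases w[i]? <;> rfl
  | succ k =>
    rw [← digitAfter_eq_testBit hk]
    simp [oldCell, hi, newCell, Symbol.digit]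

theorem mark_oldCell (hi : i < W) : (oldCell w W f k i).mark = decide (i + 1 = k) := by
  cases k with
  | zero => simp only [oldCell]; cases w[i]? <;> rfl
  | succ k => simp [oldCell, hi, newCell, Symbol.mark]

theorem tile_oldCell_zero : (oldCell w W f 0 i).tile = none := by
  simp only [oldCell]; cases w[i]? <;> rfl

theorem last_oldCell_zero : (oldCell w W f 0 i).last = none := by
  simp only [oldCell]; cases w[i]? <;> rfl

theorem tile_oldCell_succ (hi : i < W) : (oldCell w W f (k + 1) i).tile = some (f i k) := by
  simp [oldCell, hi, newCell, Symbol.tile]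

theorem last_oldCell_succ (hi : i < W) :
    (oldCell w W f (k + 1) i).last = some (decide (i + 1 = W)) := by
  simp [oldCell, hi, newCell, Symbol.last]

theorem ok_oldCell :
    (oldCell w W f k i).ok (okBefore w k i) = okBefore w k (i + 1) := by
  cases k with
  | zero =>
    simp only [oldCell, okBefore]
    rcases Nat.lt_or_ge i w.length with h | h
    · rw [List.take_succ_eq_append_getElem h, List.getLast?_concat, List.getElem?_eq_getElem h]
      simp [Symbol.ok]
    · rw [List.getElem?_eq_none h, List.take_of_length_le h,
        List.take_of_length_le (h.trans (Nat.le_succ i))]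
      rfl
  | succ k =>
    simp only [oldCell, okBefore]
    split_ifs <;> simp [newCell, Symbol.ok]

theorem length_le_of_oldCell_eq_blank (h : oldCell w W f 0 i = .blank) : w.length ≤ i := by
  by_contra h'
  simp [oldCell, List.getElem?_eq_getElem (not_le.1 h')] at h

theorem oldCell_eq_blank (hw : w.length ≤ W) (hi : W ≤ i) : oldCell w W f k i = .blank := by
  cases k with
  | zero => simp [oldCell, hw.trans hi]
  | succ k => simp [oldCell, hi]

theorem sweepTape_self : sweepTape w W f k i i = oldCell w W f k i := if_neg (lt_irrefl i)

theorem sweepTape_zero : sweepTape w W f k 0 = oldCell w W f k := by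
  funext j
  simp [sweepTape]

theorem sweepTape_eq_oldCell_succ (hw : w.length ≤ W) :
    sweepTape w W f k W = oldCell w W f (k + 1) := by
  funext j
  rw [sweepTape]
  split_ifs with h
  · simp [oldCell, h]
  · rw [oldCell_eq_blank hw (by omega), oldCell_eq_blank hw (by omega)]

/-- The primed width and tiling are needed for soundness: during the first sweep the width is still
unknown, and each guess revises the presumed data without changing what is already written. -/
theorem update_sweepTape {W' : ℕ} {f' : ℕ → ℕ → S.Tile} (hW : k = 0 ∨ W' = W)
    (hlast : ∀ j < i, j + 1 = W ↔ j + 1 = W') (hf : ∀ j < i, f' j k = f j k)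
    (hf' : ∀ j, ∀ l < k, f' j l = f j l) :
    Function.update (sweepTape w W f k i) i (newCell w W' f' k i) = sweepTape w W' f' k (i + 1) := by
  funext j
  rcases lt_trichotomy j i with h | rfl | h
  · rw [Function.update_of_ne h.ne, sweepTape, sweepTape, if_pos h, if_pos (by omega), newCell,
      newCell, hf j h]
    simp only [hlast j h]
  · rw [Function.update_self, sweepTape, if_pos (by omega)]
  · rw [Function.update_of_ne h.ne', sweepTape, sweepTape, if_neg (by omega), if_neg (by omega)]
    cases k with
    | zero => rfl
    | succ k =>
      obtain rfl := hW.resolve_left (Nat.succ_ne_zero k)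
      simp only [oldCell, newCell, hf' j k (Nat.lt_succ_self k)]

theorem borrow_succ (hk : k ≤ bitsVal w) (hi : i < W) :
    (decide ((bitsVal w - k) % 2 ^ i = 0) && !(oldCell w W f k i).digit) =
      decide ((bitsVal w - k) % 2 ^ (i + 1) = 0) := by
  rw [digit_oldCell hk hi, decide_mod_two_pow_succ]

theorem digit_xor_borrow (hk : k ≤ bitsVal w) (hi : i < W) :
    ((oldCell w W f k i).digit ^^ decide ((bitsVal w - k) % 2 ^ i = 0)) = digitAfter w k i := by
  rw [digit_oldCell hk hi, digitAfter]

theorem isNone_prev : (if i = 0 then none else some (f (i - 1) k)).isNone = decide (i = 0) := by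
  split_ifs with h <;> simp [h]

/-- The constraints at column `p` and row `q` of a tiling with `W` columns, except for those in the
final row. -/
structure GoodAt (W : ℕ) (f : ℕ → ℕ → S.Tile) (p q : ℕ) : Prop where
  horizontal : ∀ p', p = p' + 1 → (f p' q, f p q) ∈ S.H
  vertical : ∀ q', q = q' + 1 → (f p q', f p q) ∈ S.V
  corner : q = 0 → p = 0 ∨ p + 1 = W → f p q = S.corner

/-! #### Completeness -/

theorem step_rightCfg (hi : i < W) (hk : k < bitsVal w) (hk' : bitsVal w - k < 2 ^ W)
    (hgood : GoodAt W f i k) (fin' : Bool) (hfin : i = 0 ∨ fin' = fin)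
    (hcorner : fin' = true → i = 0 ∨ i + 1 = W → f i k = S.corner)
    (hdigit : fin' = true → bitsVal w = k + 1) (hmark : fin' = true → W = k + 1)
    (hok : w.getLast? = some true) :
    S.verifier.Step (rightCfg w W f k i fin)
      (if i + 1 = W then turnCfg w W f k fin' else rightCfg w W f k (i + 1) fin') := by
  have hm := Move.sweep (S := S) (prev := if i = 0 then none else some (f (i - 1) k))
    (b := decide ((bitsVal w - k) % 2 ^ i = 0)) (fin := fin) (m := decide (i = k))
    (o := okBefore w k i) (a := oldCell w W f k i) fin' (decide (i + 1 = W)) (f i k)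
    (hfin.imp_left fun h => by simp [h])
    (fun s hs => by
      rcases i with _ | i
      · simp at hs
      · obtain rfl : f i k = s := by simpa using hs
        exact hgood.horizontal i rfl)
    (fun s hs => by
      rcases k with _ | k
      · simp [tile_oldCell_zero] at hs
      · rw [tile_oldCell_succ hi] at hs
        exact Option.some.inj hs ▸ hgood.vertical k rfl)
    (fun l hl => by
      rcases k with _ | k
      · simp [last_oldCell_zero] at hl
      · rw [last_oldCell_succ hi] at hl
        exact Option.some.inj hl)
    (fun h h' => by
      replace h : i = 0 ∨ i + 1 = W := by simpa using h
      rcases h' with h' | h'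
      · rcases k with _ | k
        · exact hgood.corner rfl h
        · simp [tile_oldCell_succ hi] at h'
      · exact hcorner h' h)
    (fun h => by
      rw [digit_xor_borrow hk.le hi, digitAfter_eq_testBit hk, hdigit h]
      simp)
    (fun h h' => by
      have h' : i + 1 = W := by simpa using h'
      have := hmark h
      simp
      omega)
    (fun h => by
      obtain rfl : i + 1 = W := by simpa using h
      rw [borrow_succ hk.le hi, Nat.mod_eq_of_lt hk']
      simp
      omega)
    (fun h => by
      rcases k with _ | k
      · have := length_le_of_oldCell_eq_blank h
        simp [okBefore, List.take_of_length_le this, hok]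
      · simp [okBefore])
  rw [borrow_succ hk.le hi, mark_oldCell hi, ok_oldCell, digit_xor_borrow hk.le hi,
    isNone_prev] at hm
  rw [← newCell] at hm
  rw [← sweepTape_self] at hm
  refine verifier_step_iff.2 ⟨_, _, _, hm, ?_⟩
  have hu := update_sweepTape (w := w) (i := i) (k := k) (f := f) (.inr (Eq.refl W))
    (fun _ _ => Iff.rfl) (fun _ _ => rfl) fun _ _ _ => rfl
  split_ifs with h
  · subst h
    simp only [turnCfg, rightCfg, NTM.moveHead, decide_true, cond_true]
    exact congrArg (NTM.Cfg.mk (M := S.verifier) _ _) hu.symm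
  · simp only [h, rightCfg, NTM.moveHead, decide_false, cond_false, Nat.succ_ne_zero, if_false,
      Nat.add_sub_cancel]
    exact congrArg (NTM.Cfg.mk (M := S.verifier) _ _) hu.symm

theorem step_turnCfg_true (hw : w.length ≤ W) (hok : w.getLast? = some true) :
    ∃ c, S.verifier.Step (turnCfg w W f k true) c ∧ c.state = VState.accept := by
  have hm : S.Move (turnCfg w W f k true).state
      ((turnCfg w W f k true).tape (turnCfg w W f k true).head) .accept .blank .left := by
    simp only [turnCfg, sweepTape_self, okBefore, List.take_of_length_le hw, hok, or_true,
      decide_true, oldCell_eq_blank hw le_rfl]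
    exact .accept
  exact ⟨_, verifier_step_iff.2 ⟨_, _, _, hm, rfl⟩, rfl⟩

theorem turn_back_eq (hw : w.length ≤ W) :
    (⟨VState.left, NTM.moveHead .left W, Function.update (sweepTape w W f k W) W .blank⟩ :
      S.verifier.Cfg) = leftCfg w W f (k + 1) (W - 1) := by
  simp only [leftCfg, NTM.moveHead, sweepTape_eq_oldCell_succ hw]
  rw [← oldCell_eq_blank (f := f) (k := k + 1) hw le_rfl]
  exact congrArg (NTM.Cfg.mk (M := S.verifier) _ _) (Function.update_eq_self _ _)

theorem step_turnCfg_false (hw : w.length ≤ W) (hok : w.getLast? = some true) :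
    S.verifier.Step (turnCfg w W f k false) (leftCfg w W f (k + 1) (W - 1)) := by
  have hm : S.Move (turnCfg w W f k false).state
      ((turnCfg w W f k false).tape (turnCfg w W f k false).head) .left .blank .left := by
    simp only [turnCfg, sweepTape_self, okBefore, List.take_of_length_le hw, hok, or_true,
      decide_true, oldCell_eq_blank hw le_rfl]
    exact .back
  exact verifier_step_iff.2 ⟨_, _, _, hm, (turn_back_eq hw).symm⟩

theorem step_leftCfg_succ (hi : i + 1 < W) :
    S.verifier.Step (leftCfg w W f (k + 1) (i + 1)) (leftCfg w W f (k + 1) i) := by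
  have hc : oldCell w W f (k + 1) (i + 1) = newCell w W f k (i + 1) := if_pos hi
  have hm : S.Move .left (oldCell w W f (k + 1) (i + 1)) .left (oldCell w W f (k + 1) (i + 1))
      .left := by
    rw [hc]
    exact .left _ _ _ _
  refine verifier_step_iff.2 ⟨_, _, _, hm, ?_⟩
  exact congrArg (NTM.Cfg.mk (M := S.verifier) _ _) (Function.update_eq_self _ _).symm

/-- The left move on the leftmost cell leaves the head in place, ready for the next sweep. -/
theorem step_leftCfg_zero (hW : 0 < W) :
    S.verifier.Step (leftCfg w W f (k + 1) 0) (rightCfg w W f (k + 1) 0 false) := by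
  have hc : oldCell w W f (k + 1) 0 = newCell w W f k 0 := if_pos hW
  have hm : S.Move .left (oldCell w W f (k + 1) 0) (.right none true false false true)
      (oldCell w W f (k + 1) 0) .left := by
    rw [hc]
    exact .again _ _ _ _
  refine verifier_step_iff.2 ⟨_, _, _, hm, ?_⟩
  simp [leftCfg, rightCfg, NTM.moveHead, sweepTape_zero, okBefore, Nat.mod_one]
  exact congrArg (NTM.Cfg.mk (M := S.verifier) _ _) (Function.update_eq_self _ _).symm

theorem init_eq_rightCfg : S.verifier.init w = rightCfg w W f 0 0 false := by
  simp only [NTM.init, rightCfg, sweepTape_zero]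
  congr
  simp [okBefore, verifier, Nat.mod_one]

/-- The tiling `f` of the first `N` rows and columns is valid. -/
structure IsTiling (N : ℕ) (f : ℕ → ℕ → S.Tile) : Prop where
  goodAt : ∀ p q, p < N → q < N → GoodAt N f p q
  corner : ∀ p q, q + 1 = N → p = 0 ∨ p + 1 = N → f p q = S.corner

theorem mem_TILING_iff :
    w ∈ S.TILING ↔ w.getLast? = some true ∧ ∃ f : ℕ → ℕ → S.Tile, IsTiling (bitsVal w) f := by
  rw [List.getLast?_eq_some_iff]
  constructor
  · rintro ⟨N, hN, hw, g, hg⟩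
    obtain ⟨hl, rfl⟩ := (pos_and_eq_encodeNat_iff w N).1 ⟨hN, hw⟩
    refine ⟨hl, fun p q => if h : p < bitsVal w ∧ q < bitsVal w then g ⟨p, h.1⟩ ⟨q, h.2⟩
      else S.corner, fun p q hp hq => ⟨?_, ?_, ?_⟩, ?_⟩
    · rintro p' rfl
      simp only [hq, hp, Nat.lt_of_succ_lt hp, and_self, dite_true]
      exact hg.horizontal _ _ _ rfl
    · rintro q' rfl
      simp only [hq, hp, Nat.lt_of_succ_lt hq, and_self, dite_true]
      exact hg.vertical _ _ _ rfl
    · intro h h'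
      simp only [hp, hq, and_self, dite_true]
      exact hg.corners _ _ h' (.inl h)
    · intro p q h h'
      split_ifs with h''
      · exact hg.corners _ _ h' (.inr h)
      · rfl
  · rintro ⟨hl, f, hf⟩
    obtain ⟨hN, hw⟩ := (pos_and_eq_encodeNat_iff w (bitsVal w)).2 ⟨hl, rfl⟩
    refine ⟨_, hN, hw, fun p q => f p q, ⟨?_, ?_, ?_⟩⟩
    · intro i i' j h
      exact h ▸ (hf.goodAt i' j i'.2 j.2).horizontal i h
    · intro i j j' h
      exact (hf.goodAt i j' i.2 j'.2).vertical j h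
    · rintro i j h (h' | h')
      · exact (hf.goodAt i j i.2 j.2).corner h' h
      · exact hf.corner i j h' h

/-- This ensures that a row of the tiling covers the whole input, so that a blank follows its last
column. -/
theorem length_le_bitsVal (h : w.getLast? = some true) : w.length ≤ bitsVal w := by
  obtain ⟨l, rfl⟩ := List.getLast?_eq_some_iff.1 h
  have := two_pow_le_bitsVal l
  have := Nat.lt_two_pow_self (n := l.length)
  simp
  omega

theorem IsTiling.reachesIn_turnCfg (hf : IsTiling (bitsVal w) f) (hok : w.getLast? = some true)
    {t : ℕ} (hk : k < bitsVal w)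
    (hr : S.verifier.ReachesIn t (S.verifier.init w) (rightCfg w (bitsVal w) f k 0 false)) :
    S.verifier.ReachesIn (t + bitsVal w) (S.verifier.init w)
      (turnCfg w (bitsVal w) f k (decide (k + 1 = bitsVal w))) := by
  set N := bitsVal w with hN
  have hstep : ∀ i < N, S.verifier.Step (rightCfg w N f k i (decide (i ≠ 0 ∧ k + 1 = N)))
      (if i + 1 = N then turnCfg w N f k (decide (k + 1 = N))
        else rightCfg w N f k (i + 1) (decide (k + 1 = N))) := by
    intro i hi
    refine step_rightCfg hi hk ((Nat.sub_le _ _).trans_lt Nat.lt_two_pow_self) (hf.goodAt i k hi hk)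
      _ ?_ ?_ ?_ ?_ hok
    · rcases i with _ | i <;> simp
    · exact fun h h' => hf.corner i k (by simpa using h) h'
    · exact fun h => (by simpa using h : k + 1 = N).symm
    · exact fun h => (by simpa using h : k + 1 = N).symm
  have hi : ∀ i < N, S.verifier.ReachesIn (t + i) (S.verifier.init w)
      (rightCfg w N f k i (decide (i ≠ 0 ∧ k + 1 = N))) := by
    intro i
    induction i with
    | zero => intro _; simpa using hr
    | succ i ih =>
      intro hi
      have h := hstep i (by omega)
      rw [if_neg (by omega)] at h
      exact ⟨_, ih (by omega), by simpa using h⟩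
  obtain ⟨n, hn⟩ : ∃ n, N = n + 1 := ⟨N - 1, by omega⟩
  have h := hstep n (by omega)
  rw [if_pos hn.symm] at h
  have h' := hi n (by omega)
  rw [show t + N = t + n + 1 by omega]
  exact ⟨_, h', h⟩

/-- Each row costs `N` steps to the right, one to turn, `N - 1` to the left and one to restart. -/
theorem IsTiling.reachesIn_rightCfg (hf : IsTiling (bitsVal w) f) (hok : w.getLast? = some true)
    (hk : k < bitsVal w) :
    S.verifier.ReachesIn (k * (2 * bitsVal w + 1)) (S.verifier.init w)
      (rightCfg w (bitsVal w) f k 0 false) := by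
  induction k with
  | zero => rw [Nat.zero_mul]; exact init_eq_rightCfg
  | succ k ih =>
    have h := hf.reachesIn_turnCfg hok (by omega) (ih (by omega))
    rw [decide_eq_false hk.ne] at h
    have hleft : ∀ j < bitsVal w, S.verifier.ReachesIn
        (k * (2 * bitsVal w + 1) + bitsVal w + 1 + j) (S.verifier.init w)
        (leftCfg w (bitsVal w) f (k + 1) (bitsVal w - 1 - j)) := by
      intro j
      induction j with
      | zero => exact fun _ => ⟨_, h, step_turnCfg_false (length_le_bitsVal hok) hok⟩
      | succ j ih =>
        intro hj
        refine ⟨_, ih (by omega), ?_⟩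
        rw [show bitsVal w - 1 - j = bitsVal w - 1 - (j + 1) + 1 by omega]
        exact step_leftCfg_succ (by omega)
    have h' := hleft (bitsVal w - 1) (by omega)
    rw [Nat.sub_self] at h'
    rw [show (k + 1) * (2 * bitsVal w + 1) =
      k * (2 * bitsVal w + 1) + bitsVal w + 1 + (bitsVal w - 1) + 1 by rw [add_mul]; omega]
    exact ⟨_, h', step_leftCfg_zero (by omega)⟩

/-- With `N = n + 1` the total is `n * (2 * N + 1) + N + 1 = 2 * N ^ 2`, and `N < 2 ^ w.length`. -/
theorem acceptsWithin_of_mem_TILING (h : w ∈ S.TILING) :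
    S.verifier.AcceptsWithin w (2 ^ (2 * w.length + 1)) := by
  obtain ⟨hok, f, hf⟩ := mem_TILING_iff.1 h
  have hlt := bitsVal_lt w
  obtain ⟨n, hn⟩ : ∃ n, bitsVal w = n + 1 := by
    have := length_le_bitsVal hok
    have : w.length ≠ 0 := fun h => by simp [List.length_eq_zero_iff.1 h] at hok
    exact ⟨bitsVal w - 1, by omega⟩
  have ht := hf.reachesIn_turnCfg hok (by omega) (hf.reachesIn_rightCfg hok (k := n) (by omega))
  rw [decide_eq_true hn.symm] at ht
  obtain ⟨c, hc, hc'⟩ := step_turnCfg_true (f := f) (k := n) (length_le_bitsVal hok) hok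
  refine ⟨n * (2 * bitsVal w + 1) + bitsVal w + 1, ?_, c, ⟨_, ht, hc⟩, hc'⟩
  have : (n + 1) * (n + 1) ≤ 2 ^ w.length * 2 ^ w.length := Nat.mul_le_mul (by omega) (by omega)
  rw [pow_succ, two_mul w.length, pow_add, hn]
  nlinarith

/-! #### Soundness -/

/-- The first `i` columns of row `k` have been written. -/
structure Progress (w : List Bool) (W : ℕ) (f : ℕ → ℕ → S.Tile) (k i : ℕ) (fin : Bool) : Prop where
  le : k ≤ bitsVal w
  goodAt : ∀ p q, p < W → q < k ∨ q = k ∧ p < i → GoodAt W f p q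
  digit : fin = true → ∀ j < i, digitAfter w k j = false
  corner : fin = true → 0 < i → f 0 k = S.corner
  input : 0 < k → w.length ≤ W ∧ w.getLast? = some true

/-- The reachable configurations. -/
inductive Invariant (w : List Bool) : S.verifier.Cfg → Prop
  | right {W k i : ℕ} {f : ℕ → ℕ → S.Tile} {fin : Bool} (h : Progress w W f k i fin) (hi : i < W) :
      Invariant w (rightCfg w W f k i fin)
  | turn {W k : ℕ} {f : ℕ → ℕ → S.Tile} {fin : Bool} (h : Progress w W f k W fin) (hW : 0 < W)
      (hk : k < bitsVal w)
      (hfin : fin = true → f (W - 1) k = S.corner ∧ W = k + 1) :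
      Invariant w (turnCfg w W f k fin)
  | left {W k i : ℕ} {f : ℕ → ℕ → S.Tile} (h : Progress w W f (k + 1) 0 false) (hi : i < W) :
      Invariant w (leftCfg w W f (k + 1) i)
  | accept {c : S.verifier.Cfg} (hc : c.state = VState.accept) (h : w ∈ S.TILING) : Invariant w c

theorem Progress.input_of_blank (h : Progress w W f k W fin) (hok : okBefore w k W = true)
    (hb : sweepTape w W f k W W = .blank) : w.length ≤ W ∧ w.getLast? = some true := by
  rcases k with _ | k
  · rw [sweepTape_self] at hb
    have hle := length_le_of_oldCell_eq_blank hb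
    exact ⟨hle, by simpa [okBefore, List.take_of_length_le hle] using hok⟩
  · exact h.input (Nat.succ_pos k)

/-- The vanishing counter gives `N = k + 1`: its digits beyond column `W` are 0 because the input is
no longer than `W`. The diagonal mark gives `W = k + 1`, so the grid is the required square. -/
theorem Progress.mem_TILING (h : Progress w W f k W true) (hW : 0 < W) (hk : k < bitsVal w)
    (hfin : f (W - 1) k = S.corner ∧ W = k + 1) (hw : w.length ≤ W)
    (hok : w.getLast? = some true) : w ∈ S.TILING := by
  have hN : bitsVal w = k + 1 := by
    have hz : bitsVal w - (k + 1) = 0 := by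
      refine Nat.eq_of_testBit_eq fun j => ?_
      rw [Nat.zero_testBit]
      rcases Nat.lt_or_ge j W with hj | hj
      · rw [← digitAfter_eq_testBit hk]
        exact h.digit rfl j hj
      · refine Nat.testBit_lt_two_pow ((Nat.sub_le _ _).trans_lt ((bitsVal_lt w).trans_le ?_))
        exact Nat.pow_le_pow_right (by norm_num) (hw.trans hj)
    omega
  obtain ⟨hc, rfl⟩ := hfin
  refine mem_TILING_iff.2 ⟨hok, f, ?_⟩
  rw [hN]
  refine ⟨fun p q hp hq => h.goodAt p q hp (by omega), fun p q hq hp => ?_⟩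
  obtain rfl : q = k := by omega
  rcases hp with rfl | hp
  · exact h.corner rfl hW
  · obtain rfl : p = q := by omega
    exact hc

theorem Progress.succ {W' : ℕ} {f' : ℕ → ℕ → S.Tile} {fin' : Bool} (h : Progress w W f k i fin)
    (hW : k = 0 ∨ W' = W) (hlast : ∀ j < i, j + 1 = W ↔ j + 1 = W')
    (hf' : ∀ p q, q < k ∨ q = k ∧ p < i → f' p q = f p q) (hgood : GoodAt W' f' i k)
    (hi : i < W) (hfin : i = 0 ∨ fin' = fin) (hdigit : fin' = true → digitAfter w k i = false)
    (hcorner : fin' = true → i = 0 → f' i k = S.corner) : Progress w W' f' k (i + 1) fin' where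
  le := h.le
  goodAt p q hp hq := by
    by_cases hpq : q = k ∧ p = i
    · obtain ⟨rfl, rfl⟩ := hpq
      exact hgood
    have hq' : q < k ∨ q = k ∧ p < i := by omega
    have hg := h.goodAt p q (by omega) hq'
    refine ⟨?_, ?_, ?_⟩
    · rintro p' rfl
      rw [hf' _ _ hq', hf' p' q (by omega)]
      exact hg.horizontal p' rfl
    · rintro q' rfl
      rw [hf' _ _ hq', hf' p q' (by omega)]
      exact hg.vertical q' rfl
    · intro h0 hp'
      rw [hf' _ _ hq']
      refine hg.corner h0 (hp'.imp_right fun hp' => ?_)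
      rcases hW with rfl | rfl
      · exact (hlast p (by omega)).2 hp'
      · exact hp'
  digit hfin' j hj := by
    rcases Nat.lt_succ_iff_lt_or_eq.1 hj with hj | rfl
    · exact h.digit (hfin.resolve_left (by omega) ▸ hfin') j hj
    · exact hdigit hfin'
  corner hfin' _ := by
    rcases Nat.eq_zero_or_pos i with rfl | hi
    · exact hcorner hfin' rfl
    · rw [hf' 0 k (.inr ⟨rfl, hi⟩)]
      exact h.corner (hfin.resolve_left hi.ne' ▸ hfin') hi
  input hk := by
    obtain rfl := hW.resolve_left hk.ne'
    exact h.input hk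

/-- The move supplies a tile and the flag `last`; the presumed tiling and width are adapted to them,
after which the local checks of `Move.sweep` are the constraints at the new cell. -/
theorem Progress.step (h : Progress w W f k i fin) (hi : i < W) {c : S.verifier.Cfg}
    (hc : S.verifier.Step (rightCfg w W f k i fin) c) : Invariant w c := by
  obtain ⟨q, b, d, hm, rfl⟩ := verifier_step_iff.1 hc
  generalize hs : (rightCfg w W f k i fin).state = s at hm
  generalize ha : (rightCfg w W f k i fin).tape (rightCfg w W f k i fin).head = a at hm
  replace ha : oldCell w W f k i = a := sweepTape_self.symm.trans ha
  cases hm with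
  | sweep fin' last t fin_eq horizontal vertical last_eq corner digit_eq mark_eq borrow_eq ok_eq =>
    obtain ⟨rfl, rfl, rfl, rfl, rfl⟩ := VState.right.inj hs
    subst ha
    -- In the first row the width stays provisional: `i + 2` is the least value for which column `i`
    -- is not the last.
    let W' := if k = 0 then (if last then i + 1 else i + 2) else W
    let f' : ℕ → ℕ → S.Tile := fun p q => if q = k ∧ p = i then t else f p q
    have hW : k = 0 ∨ W' = W := by
      by_cases hk : k = 0
      · exact .inl hk
      · exact .inr (if_neg hk)
    have hlt : i < W' := by
      simp only [W']
      split_ifs <;> omega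
    have hlast : last = decide (i + 1 = W') := by
      rcases k with _ | k
      · cases last <;> simp [W']
      · exact last_eq _ (last_oldCell_succ hi)
    have hlast' : ∀ j < i, j + 1 = W ↔ j + 1 = W' := by
      intro j hj
      omega
    have hft : f' i k = t := if_pos ⟨rfl, rfl⟩
    have hf' : ∀ p q, q < k ∨ q = k ∧ p < i → f' p q = f p q := fun p q h => if_neg (by omega)
    have hprev : (if i = 0 then none else some (f (i - 1) k)) = none ↔ i = 0 := by
      split_ifs with h <;> simp [h]
    rw [hprev] at fin_eq corner
    have hgood : GoodAt W' f' i k := by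
      refine ⟨?_, ?_, ?_⟩
      · rintro i rfl
        rw [hft, hf' i k (by omega)]
        exact horizontal _ (by simp)
      · rintro k rfl
        rw [hft, hf' i k (by omega)]
        exact vertical _ (tile_oldCell_succ hi)
      · rintro rfl hi'
        rw [hft]
        exact corner (hi'.imp_right fun h => by simp [hlast, h]) (.inl tile_oldCell_zero)
    rw [digit_xor_borrow h.le hi] at digit_eq
    rw [borrow_succ h.le hi] at borrow_eq
    have hp : Progress w W' f' k (i + 1) fin' :=
      h.succ hW hlast' hf' hgood hi fin_eq digit_eq fun hfin' hi' => by
        rw [hft]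
        exact corner (.inl hi') (.inr hfin')
    have hu := update_sweepTape (w := w) hW hlast' (fun j hj => hf' j k (.inr ⟨rfl, hj⟩))
      (fun j l hl => hf' j l (.inl hl))
    rw [newCell, hft, ← hlast] at hu
    rw [borrow_succ h.le hi, mark_oldCell hi, ok_oldCell, digit_xor_borrow h.le hi, isNone_prev]
    cases last with
    | true =>
      have hiW : i + 1 = W' := by simpa using hlast.symm
      have hcfg : Invariant w (turnCfg w W' f' k fin') := by
        refine .turn (hiW ▸ hp) (by omega) (lt_of_le_of_ne h.le ?_) fun hfin' => ⟨?_, ?_⟩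
        -- If the counter were already 0, the decrement would leave a borrow in the last column.
        · rintro rfl
          simpa using borrow_eq rfl
        · rw [← hiW, Nat.add_sub_cancel, hft]
          exact corner (.inr rfl) (.inr hfin')
        · have : i = k := by simpa using mark_eq hfin' rfl
          omega
      convert hcfg using 1
      rw [turnCfg, ← hiW]
      rw [← hiW] at hu
      exact congrArg (NTM.Cfg.mk (M := S.verifier) _ _) hu
    | false =>
      have hiW : i + 1 ≠ W' := by simpa using hlast.symm
      have hcfg : Invariant w (rightCfg w W' f' k (i + 1) fin') := .right hp (by omega)
      convert hcfg using 1
      simp only [rightCfg, Nat.succ_ne_zero, if_false, Nat.add_sub_cancel, hft]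
      exact congrArg (NTM.Cfg.mk (M := S.verifier) _ _) hu
  | _ => cases hs

theorem Invariant.step {c c' : S.verifier.Cfg} (h : Invariant w c) (hc : S.verifier.Step c c') :
    Invariant w c' := by
  cases h with
  | right h hi => exact h.step hi hc
  | @turn W k f fin h hW hk hfin =>
    obtain ⟨q, b, d, hm, rfl⟩ := verifier_step_iff.1 hc
    generalize hs : (turnCfg w W f k fin).state = s at hm
    generalize ha : (turnCfg w W f k fin).tape (turnCfg w W f k fin).head = a at hm
    cases hm with
    | accept =>
      obtain ⟨rfl, hok⟩ := VState.turn.inj hs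
      obtain ⟨hw, hl⟩ := h.input_of_blank hok ha
      exact .accept rfl (h.mem_TILING hW hk (hfin rfl) hw hl)
    | back =>
      obtain ⟨rfl, hok⟩ := VState.turn.inj hs
      obtain ⟨hw, hl⟩ := h.input_of_blank hok ha
      have hinv : Invariant w (leftCfg w W f (k + 1) (W - 1)) :=
        .left ⟨hk, fun p q hp hq => h.goodAt p q hp (by omega), by simp, by simp, fun _ => ⟨hw, hl⟩⟩
          (by omega)
      convert hinv using 1
      exact turn_back_eq hw
    | _ => cases hs
  | @left W k i f h hi =>
    obtain ⟨q, b, d, hm, rfl⟩ := verifier_step_iff.1 hc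
    generalize hs : (leftCfg w W f (k + 1) i).state = s at hm
    generalize ha : (leftCfg w W f (k + 1) i).tape (leftCfg w W f (k + 1) i).head = a at hm
    have ha' : newCell w W f k i = a := (if_pos hi).symm.trans ha
    have hu : Function.update (oldCell w W f (k + 1)) i a = oldCell w W f (k + 1) := by
      rw [← ha]
      exact Function.update_eq_self _ _
    cases hm with
    | left l t d m =>
      have hinv : Invariant w (leftCfg w W f (k + 1) (i - 1)) := .left h (by omega)
      convert hinv using 1
      exact congrArg (NTM.Cfg.mk (M := S.verifier) _ _) hu
    | again l t d m =>
      obtain rfl : i = 0 := by simpa using (Symbol.cell.inj ha').1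
      have hinv : Invariant w (rightCfg w W f (k + 1) 0 false) := .right h hi
      convert hinv using 1
      simp only [rightCfg, sweepTape_zero, okBefore, pow_zero, Nat.mod_one]
      exact congrArg (NTM.Cfg.mk (M := S.verifier) _ _) hu
    | _ => cases hs
  | accept hs h =>
    obtain ⟨q, b, d, hm, rfl⟩ := verifier_step_iff.1 hc
    rw [hs] at hm
    cases hm

theorem mem_TILING_of_acceptsWithin {t : ℕ} (h : S.verifier.AcceptsWithin w t) : w ∈ S.TILING := by
  obtain ⟨s, -, c, hr, hc⟩ := h
  have hinv : Invariant w c := by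
    clear hc
    induction s generalizing c with
    | zero =>
      obtain rfl : S.verifier.init w = c := hr
      -- Nothing has been written, so any positive width and any tiling would do.
      rw [init_eq_rightCfg (W := 1) (f := fun _ _ => S.corner)]
      exact .right ⟨Nat.zero_le _, by simp, by simp, by simp, by simp⟩ one_pos
    | succ s ih =>
      obtain ⟨c', hr, hs⟩ := hr
      exact (ih c' hr).step hs
  cases hinv with
  | accept _ h => exact h
  | _ => cases hc

/-- Tiling problems are in `NEXP`. -/
theorem TILING_mem_NEXP (S : TilingSystem) : S.TILING ∈ NEXP := by
  refine Set.mem_iUnion.2 ⟨2 * Polynomial.X + 1, S.verifier, fun x => ⟨fun h => ⟨_,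
    acceptsWithin_of_mem_TILING h⟩, fun ⟨t, h⟩ => mem_TILING_of_acceptsWithin h⟩, fun x h => ?_⟩
  simpa using acceptsWithin_of_mem_TILING h

end TilingSystem

/-- The tiling problem is NEXP-complete: for every choice of the fixed parameters it is in NEXP,
and for some fixed choice of the parameters it is NEXP-complete. -/
theorem theorem1 :
    (∀ S : TilingSystem, S.TILING ∈ NEXP) ∧ ∃ S : TilingSystem, NEXPComplete S.TILING :=
  ⟨TilingSystem.TILING_mem_NEXP, universalSystem.toTilingSystem,
    TilingSystem.TILING_mem_NEXP _, fun _ h => polyTimeReducible_universalSystem h⟩
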